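/- Let $\Bbbk$ be an algebraically closed field of characteristic $0$, let $a,b,k,\ell,p,q,t\in\Bbbk$ with $t\neq 0$, and let $V$ be the vector space with basis $x_1,x_2,x_3$ and with the braiding $c\colon V\otimes V\to V\otimes V$ associated with the solution $\mathfrak R_{1,5}$ of the quantum Yang–Baxter equation: \begin{align*} c(x_1\otimes x_1)&=t\,x_1\otimes x_1, & c(x_2\otimes x_1)&=t\,x_1\otimes x_2+t\ell\,x_1\otimes x_1,\\ c(x_3\otimes x_1)&=t\,x_1\otimes x_3, & c(x_1\otimes x_2)&=t\,x_2\otimes x_1-t\ell\,x_1\otimes x_1,\\ c(x_1\otimes x_3)&=t\,x_3\otimes x_1+tp\,x_1\otimes x_1, \end{align*} \begin{align*} c(x_2\otimes x_2)&=t\,x_2\otimes x_2+t\ell\,x_2\otimes x_1-t\ell\,x_1\otimes x_2-t\ell^2\,x_1\otimes x_1,\\ c(x_3\otimes x_2)&=t\,x_2\otimes x_3-t\ell\,x_1\otimes x_3+t(\ell q-k)\,x_1\otimes x_1,\\ c(x_2\otimes x_3)&=t\,x_3\otimes x_2+t\ell\,x_3\otimes x_1+t(p-q)\,x_2\otimes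 x_1+tq\,x_1\otimes x_2+tk\,x_1\otimes x_1,\\ c(x_3\otimes x_3)&=t\,x_3\otimes x_3+tp\,x_1\otimes x_3-tb\,x_2\otimes x_1+tb\,x_1\otimes x_2+ta\,x_1\otimes x_1. \end{align*} Let $\mathcal J(V)=\bigoplus_{n\ge 2}\ker Q_n\subseteq T(V)$, where $Q_n=\sum_{\sigma\in\mathbb S_n}\rho_n(M(\sigma))\in\operatorname{End}(T^n(V))$ is the $n$-th quantum symmetrizer of $c$ ($\rho_n$ is the representation of the braid group $\mathbb B_n$ on $T^n(V)$ induced by $c$, and $M\colon\mathbb S_n\to\mathbb B_n$ is the Matsumoto section), and let $\mathfrak B(V)=T(V)/\mathcal J(V)$ be the Nichols algebra of $(V,c)$. A set of ordered monomials $x_1^{a_1}x_2^{a_2}x_3^{a_3}$ that is a linear basis of $\mathfrak B(V)$ is called a PBW-basis. Assume that $t=-1$ and $p=0$. (1) If $a\neq b\ell$, then $\mathcal J(V)$ is the two-sided ideal $$\langle x_2x_1+x_1x_2,\ x_3x_1+x_1x_3,\ x_3x_2+x_2x_3-\ell\,x_1x_3+q\,x_1x_2,\ x_1^2,\ x_2^2-\ell\,x_1x_2\rangle,$$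 the set $B_1=\{x_1^{a_1}x_2^{a_2}x_3^{a_3}: a_1,a_2\in\{0,1\},\ a_3\ge 0\}$ is a PBW-basis of $\mathfrak B(V)$, and $\operatorname{GKdim}\mathfrak B(V)=1$. (2) If $a=b\ell$, then $\mathcal J(V)$ is the two-sided ideal $$\langle x_2x_1+x_1x_2,\ x_3x_1+x_1x_3,\ x_3x_2+x_2x_3-\ell\,x_1x_3+q\,x_1x_2,\ x_1^2,\ x_2^2-\ell\,x_1x_2,\ x_3^2+b\,x_1x_2\rangle,$$ the set $B_0=\{x_1^{a_1}x_2^{a_2}x_3^{a_3}: a_1,a_2,a_3\in\{0,1\}\}$ is a PBW-basis of $\mathfrak B(V)$, and $\dim\mathfrak B(V)=8$. -/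

import Mathlib

namespace NicholsRankThree

noncomputable section

/-! ### The Nichols algebra of a braiding given in a basis

`V` is the vector space with basis `x_i`, `i : ι`. A linear endomorphism `c` of `V ⊗ V` is given by
its matrix `r`, whose entry in row `(k, l)` and column `(i, j)` is the coefficient `r^{ij}_{kl}` of
`x_k ⊗ x_l` in `c (x_i ⊗ x_j)`. The tensor algebra `T(V)` is the free algebra on the `x_i`. -/

section Nichols

variable {K : Type*} [Field K] {ι : Type*} [Fintype ι] [DecidableEq ι]

/-- The tensor power `T^n(V)`, in coordinates with respect to the words
`x_{w 0} ⊗ ⋯ ⊗ x_{w (n - 1)}` of length `n`. -/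
abbrev TPow (K : Type*) (ι : Type*) (n : ℕ) : Type _ := (Fin n → ι) → K

/-- The inclusion `T^n(V) → T(V)`. -/
def toFree (K : Type*) [Field K] (ι : Type*) [Fintype ι] [DecidableEq ι] (n : ℕ) :
    TPow K ι n →ₗ[K] FreeAlgebra K ι :=
  Fintype.linearCombination K
    (fun w : Fin n → ι => (List.ofFn fun i => FreeAlgebra.ι K (w i)).prod)

/-- The operator on `T^n(V)` that applies `c` to the tensor factors at the positions `i` and `i + 1`
(positions are counted from `0`), that is `ρ_n` of the corresponding generator of the braid group.
It is only used for `i + 1 < n`. -/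
def braidAt (r : Matrix (ι × ι) (ι × ι) K) (n i : ℕ) : Module.End K (TPow K ι n) :=
  if h : i + 1 < n then
    { toFun := fun f w => ∑ u : ι × ι,
        r (w ⟨i, by omega⟩, w ⟨i + 1, h⟩) u *
          f (Function.update (Function.update w ⟨i, by omega⟩ u.1) ⟨i + 1, h⟩ u.2)
      map_add' := fun f g => by
        funext w
        simp [mul_add, Finset.sum_add_distrib]
      map_smul' := fun m f => by
        funext w
        simp [Finset.mul_sum, mul_left_comm] }
  else 1

/-- A reduced word for a permutation `σ`, in the adjacent transpositions `s_i = (i, i + 1)`.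
Let `m = σ⁻¹ 0`. The product `s_0 s_1 ⋯ s_{m-1}` sends `m` to `0`, is increasing on the remaining
points, and `σ = σ' s_0 s_1 ⋯ s_{m-1}` where `σ'` fixes `0`; the number of inversions of `σ` is that
of `σ'` plus `m`. The permutation `σ'` is, on the remaining points, a permutation of one point less
(with the points shifted by one), to which the construction is applied again. -/
def reducedWord : (n : ℕ) → Equiv.Perm (Fin n) → List ℕ
  | 0, _ => []
  | n + 1, σ =>
      (reducedWord n (Equiv.removeNone
        ((finSuccEquiv' (σ.symm 0)).symm.trans (σ.trans (finSuccEquiv n))))).map (fun i => i + 1)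
        ++ List.range (σ.symm 0 : ℕ)

/-- `ρ_n (M (σ))`, where `M` is the Matsumoto section: the value of a reduced word of `σ`. -/
def matsumoto (r : Matrix (ι × ι) (ι × ι) K) (n : ℕ) (σ : Equiv.Perm (Fin n)) :
    Module.End K (TPow K ι n) :=
  ((reducedWord n σ).map (braidAt r n)).prod

/-- The quantum symmetrizer `Q_n = ∑_{σ ∈ S_n} ρ_n (M (σ))`. -/
def quantumSymmetrizer (r : Matrix (ι × ι) (ι × ι) K) (n : ℕ) : Module.End K (TPow K ι n) :=
  ∑ σ : Equiv.Perm (Fin n), matsumoto r n σ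

/-- `J(V) = ⨁_{n ≥ 2} ker Q_n`, as a subspace of `T(V)`. -/
def defRel (r : Matrix (ι × ι) (ι × ι) K) : Submodule K (FreeAlgebra K ι) :=
  ⨆ (n : ℕ) (_ : 2 ≤ n), (LinearMap.ker (quantumSymmetrizer r n)).map (toFree K ι n)

/-- The Nichols algebra `B(V) = T(V) / J(V)`. (For a braiding, `J(V)` is already a two-sided ideal;
taking the two-sided ideal that it generates makes the quotient an algebra by construction.) -/
abbrev NicholsAlgebra (r : Matrix (ι × ι) (ι × ι) K) : Type _ :=
  FreeAlgebra K ι ⧸ (TwoSidedIdeal.span (defRel r : Set (FreeAlgebra K ι))).asIdeal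

/-- The class of `x_i` in `B(V)`. -/
def NicholsAlgebra.gen (r : Matrix (ι × ι) (ι × ι) K) (i : ι) : NicholsAlgebra r :=
  Ideal.Quotient.mk _ (FreeAlgebra.ι K i)

end Nichols

/-- The ordered monomials `x_1^{a_1} x_2^{a_2} x_3^{a_3}` with `a_i < h_i` (where `h_i = ⊤` means
that `a_i` is not restricted) form a linear basis of `A`. -/
def IsPBWBasis (K : Type*) [Field K] {A : Type*} [Ring A] [Algebra K A]
    (x : Fin 3 → A) (h : Fin 3 → ℕ∞) : Prop :=
  let mon : {e : Fin 3 → ℕ // ∀ i, (e i : ℕ∞) < h i} → A :=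
    fun e => x 0 ^ e.1 0 * x 1 ^ e.1 1 * x 2 ^ e.1 2
  LinearIndependent K mon ∧ Submodule.span K (Set.range mon) = ⊤

/-- The Gelfand-Kirillov dimension
`sup_W limsup_n log (dim (K + W + W^2 + ⋯ + W^n)) / log n`,
where `W` runs over the finite-dimensional subspaces of `A`. -/
def gkDim (K : Type*) [Field K] (A : Type*) [Ring A] [Algebra K A] : EReal :=
  ⨆ (W : Submodule K A) (_ : W.FG),
    Filter.limsup (fun n : ℕ =>
      ((Real.log (Module.finrank K (⨆ i ∈ Finset.range (n + 1), W ^ i : Submodule K A)) /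
        Real.log n : ℝ) : EReal)) Filter.atTop

/-! ### The braiding of type `R_{1,5}` -/

section R15

variable {K : Type*} [Field K]

/-- The `9 × 9` matrix `R_{1,5}`. Its rows are indexed by the pairs `(k, l)` in the order
`11, 12, 13, 21, 22, 23, 31, 32, 33`, its columns by the pairs `(i, j)` in the order
`11, 21, 31, 12, 22, 32, 13, 23, 33`. -/
def R15 (t p a b k ℓ q : K) : Matrix (Fin 9) (Fin 9) K :=
  !![t, t * ℓ, 0,  -(t * ℓ), -(t * ℓ ^ 2), t * (ℓ * q - k),  t * p, t * k, t * a;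
     0, t, 0,  0, -(t * ℓ), 0,  0, t * q, t * b;
     0, 0, t,  0, 0, -(t * ℓ),  0, 0, t * p;
     0, 0, 0,  t, t * ℓ, 0,  0, t * (p - q), -(t * b);
     0, 0, 0,  0, t, 0,  0, 0, 0;
     0, 0, 0,  0, 0, t,  0, 0, 0;
     0, 0, 0,  0, 0, 0,  t, t * ℓ, 0;
     0, 0, 0,  0, 0, 0,  0, t, 0;
     0, 0, 0,  0, 0, 0,  0, 0, t]

/-- The matrix of the braiding `c (x_i ⊗ x_j) = ∑_{k, l} r^{ij}_{kl} x_k ⊗ x_l` associated with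
`R_{1,5}`. The basis vectors are indexed by `Fin 3`, so that `0, 1, 2` stand for `1, 2, 3`;
`finProdFinEquiv (u, v) = v + 3 * u`. -/
def braiding15 (t p a b k ℓ q : K) : Matrix (Fin 3 × Fin 3) (Fin 3 × Fin 3) K :=
  fun row col => R15 t p a b k ℓ q (finProdFinEquiv (row.1, row.2)) (finProdFinEquiv (col.2, col.1))

/-- The basis vector `x_1` in `T(V)`. -/
abbrev x₁ (K : Type*) [Field K] : FreeAlgebra K (Fin 3) := FreeAlgebra.ι K 0
/-- The basis vector `x_2` in `T(V)`. -/
abbrev x₂ (K : Type*) [Field K] : FreeAlgebra K (Fin 3) := FreeAlgebra.ι K 1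
/-- The basis vector `x_3` in `T(V)`. -/
abbrev x₃ (K : Type*) [Field K] : FreeAlgebra K (Fin 3) := FreeAlgebra.ι K 2

end R15

end

end NicholsRankThree

open NicholsRankThree

/-! The Nichols algebra is recognised through skew derivations. The quantum symmetrizer factors as
$Q_{n+1}=(\mathrm{id}\otimes Q_n)S_{n+1}$, where $S_{n+1}$ (`firstShuffle`) sums over the tensor
factor that is braided to the front, and the recursion for $S$ matches the Leibniz rule in
`SkewDerivations`. So in an algebra $A$ with such derivations, iterated derivations followed by the
counit read off the coefficients of $Q_nf$. If they separate the points of $A$, then $\mathcal J(V)$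
is the kernel of $T(V)\to A$ (`SkewDerivations.mem_defRel_iff`).

This is applied to $A=T(V)/I$, with $I$ the proposed ideal. The derivations exist on $A$ because the
operators `skewOp` satisfy the relations (`exists_skewDerivations`). Separation rests on
$z=x_3^2+b\,x_1x_2$: `d 1` and `d 2` kill every $P(z)$, while `d 0` sends it to
$(b\ell-a)\,x_1P'(z)$. Applying `d 2` and `d 1` strips off $x_3$ and $x_2$, and `d 0` applied twice
differentiates the remaining polynomials in $z$, which detects them in characteristic $0$ if $a\ne
b\ell$. If $a=b\ell$, all derivations kill $z$; it becomes a relation and only constants remain.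

The ordered monomials span by rewriting. For $a\neq b\ell$, trading powers of $x_3$ for powers of
$z$ gives their independence, and counting them gives linear growth. -/

namespace NicholsRankThree

noncomputable section

set_option linter.unusedSectionVars false

/-! ### Factorisation of the quantum symmetrizer -/

section Symmetrizer

variable {K : Type*} [Field K] {ι : Type*} [Fintype ι] [DecidableEq ι]

/-- The component of a tensor along `x_k ⊗ T^n(V)`. -/
def consPart (K : Type*) [Field K] {ι : Type*} (n : ℕ) (k : ι) :
    TPow K ι (n + 1) →ₗ[K] TPow K ι n where
  toFun f w := f (Fin.cons k w)
  map_add' _ _ := rfl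
  map_smul' _ _ := rfl

@[simp] lemma consPart_apply (n : ℕ) (k : ι) (f : TPow K ι (n + 1)) (w : Fin n → ι) :
    consPart K n k f w = f (Fin.cons k w) := rfl

lemma consPart_braidAt_succ (r : Matrix (ι × ι) (ι × ι) K) (n i : ℕ) (k : ι)
    (f : TPow K ι (n + 1)) :
    consPart K n k (braidAt r (n + 1) (i + 1) f) = braidAt r n i (consPart K n k f) := by
  funext w
  by_cases h : i + 1 < n
  · have h' : i + 1 + 1 < n + 1 := by omega
    simp only [consPart_apply, braidAt, dif_pos h, dif_pos h', LinearMap.coe_mk, AddHom.coe_mk]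
    refine Finset.sum_congr rfl fun u _ => ?_
    have e1 : (⟨i + 1, by omega⟩ : Fin (n + 1)) = Fin.succ ⟨i, by omega⟩ := rfl
    have e2 : (⟨i + 1 + 1, h'⟩ : Fin (n + 1)) = Fin.succ ⟨i + 1, h⟩ := rfl
    rw [e1, e2, Fin.cons_succ, Fin.cons_succ, ← Fin.cons_update, ← Fin.cons_update]
  · have h' : ¬ i + 1 + 1 < n + 1 := by omega
    simp [braidAt, dif_neg h]

lemma consPart_prod_braidAt (r : Matrix (ι × ι) (ι × ι) K) (n : ℕ) (l : List ℕ) (k : ι)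
    (f : TPow K ι (n + 1)) :
    consPart K n k (((l.map (· + 1)).map (braidAt r (n + 1))).prod f) =
      (l.map (braidAt r n)).prod (consPart K n k f) := by
  induction l with
  | nil => simp
  | cons i l ih =>
    simp only [List.map_cons, List.prod_cons, Module.End.mul_apply]
    rw [consPart_braidAt_succ, ih]

/-- The sum of `s_0 s_1 ⋯ s_{m-1}` over all `m < n`. -/
def firstShuffle (r : Matrix (ι × ι) (ι × ι) K) (n : ℕ) : Module.End K (TPow K ι n) :=
  ∑ m : Fin n, ((List.range m).map (braidAt r n)).prod

/-- A permutation of `n + 1` points is given by the preimage of `0` and a permutation of the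
remaining points. -/
def permSplit (n : ℕ) : Fin (n + 1) × Equiv.Perm (Fin n) → Equiv.Perm (Fin (n + 1)) :=
  fun x => (finSuccEquiv' x.1).trans ((Equiv.optionCongr x.2).trans (finSuccEquiv n).symm)

lemma permSplit_symm_zero (n : ℕ) (x : Fin (n + 1) × Equiv.Perm (Fin n)) :
    (permSplit n x).symm 0 = x.1 := by
  rw [Equiv.symm_apply_eq]
  simp [permSplit]

lemma reducedWord_permSplit (n : ℕ) (x : Fin (n + 1) × Equiv.Perm (Fin n)) :
    reducedWord (n + 1) (permSplit n x) =
      (reducedWord n x.2).map (fun i => i + 1) ++ List.range x.1 := by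
  rw [reducedWord, permSplit_symm_zero]
  have : (finSuccEquiv' x.1).symm.trans ((permSplit n x).trans (finSuccEquiv n)) =
      Equiv.optionCongr x.2 := by
    ext1 y
    simp [permSplit]
  rw [this, Equiv.removeNone_optionCongr]

/-- The first entry is recovered as the preimage of `0`, the second by cancelling the outer
equivalences; surjectivity follows by counting, $(n+1)\cdot n!=(n+1)!$. -/
lemma permSplit_bijective (n : ℕ) : Function.Bijective (permSplit n) := by
  rw [Fintype.bijective_iff_injective_and_card]
  constructor
  · intro x y h
    have h1 : x.1 = y.1 := by rw [← permSplit_symm_zero, h, permSplit_symm_zero]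
    obtain ⟨m, σ⟩ := x
    obtain ⟨m', τ⟩ := y
    obtain rfl : m = m' := h1
    have : Equiv.optionCongr σ = Equiv.optionCongr τ := by
      ext1 y
      have := congrArg (fun e : Equiv.Perm (Fin (n + 1)) =>
        finSuccEquiv n (e ((finSuccEquiv' m).symm y))) h
      simpa [permSplit] using this
    rw [Equiv.optionCongr_injective this]
  · simp [Fintype.card_perm, Nat.factorial_succ]

/-- The reduced word of a permutation is a shifted reduced word, which does not touch the first
tensor factor, followed by $s_0\cdots s_{m-1}$. Summing over both pieces gives
$Q_{n+1}=(\mathrm{id}\otimes Q_n)S_{n+1}$. -/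
lemma consPart_quantumSymmetrizer (r : Matrix (ι × ι) (ι × ι) K) (n : ℕ) (k : ι)
    (f : TPow K ι (n + 1)) :
    consPart K n k (quantumSymmetrizer r (n + 1) f) =
      quantumSymmetrizer r n (consPart K n k (firstShuffle r (n + 1) f)) := by
  have h : quantumSymmetrizer r (n + 1) = ∑ x : Fin (n + 1) × Equiv.Perm (Fin n),
      matsumoto r (n + 1) (permSplit n x) :=
    ((permSplit_bijective n).sum_comp (matsumoto r (n + 1))).symm
  rw [h, Fintype.sum_prod_type]
  simp only [matsumoto, reducedWord_permSplit, List.map_append, List.prod_append,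
    quantumSymmetrizer, firstShuffle, LinearMap.sum_apply, map_sum, Module.End.mul_apply]
  refine Finset.sum_congr rfl fun m _ => Finset.sum_congr rfl fun σ _ => ?_
  rw [consPart_prod_braidAt]

lemma braidAt_zero_cons (r : Matrix (ι × ι) (ι × ι) K) (n : ℕ) (k l : ι)
    (f : TPow K ι (n + 2)) :
    consPart K n l (consPart K (n + 1) k (braidAt r (n + 2) 0 f)) =
      ∑ u : ι × ι, r (k, l) u • consPart K n u.2 (consPart K (n + 1) u.1 f) := by
  funext w
  have h : 0 + 1 < n + 2 := by omega
  simp only [consPart_apply, braidAt, dif_pos h, LinearMap.coe_mk, AddHom.coe_mk,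
    Finset.sum_apply, Pi.smul_apply, smul_eq_mul]
  refine Finset.sum_congr rfl fun u _ => ?_
  have e1 : (⟨0, by omega⟩ : Fin (n + 2)) = 0 := rfl
  have e2 : (⟨0 + 1, h⟩ : Fin (n + 2)) = Fin.succ 0 := rfl
  rw [e1, e2, Fin.cons_zero, Fin.cons_succ, Fin.cons_zero, Fin.update_cons_zero,
    ← Fin.cons_update, Fin.update_cons_zero]

lemma firstShuffle_one (r : Matrix (ι × ι) (ι × ι) K) : firstShuffle r 1 = 1 := by
  simp [firstShuffle]

/-- Splitting off $m=0$ and pulling $s_0$ out of the other terms gives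
$S_{n+2}=1+c_0(\mathrm{id}\otimes S_{n+1})$. This is the Leibniz rule of the skew derivations in
coordinates. -/
lemma firstShuffle_succ (r : Matrix (ι × ι) (ι × ι) K) (n : ℕ) (k l : ι)
    (f : TPow K ι (n + 2)) :
    consPart K n l (consPart K (n + 1) k (firstShuffle r (n + 2) f)) =
      consPart K n l (consPart K (n + 1) k f) + ∑ u : ι × ι, r (k, l) u •
        consPart K n u.2 (firstShuffle r (n + 1) (consPart K (n + 1) u.1 f)) := by
  rw [firstShuffle, Fin.sum_univ_succ]
  simp only [Fin.val_zero, List.range_zero, List.map_nil, List.prod_nil, Fin.val_succ,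
    List.range_succ_eq_map, List.map_cons, List.prod_cons, LinearMap.add_apply,
    Module.End.one_apply, map_add, LinearMap.sum_apply, Module.End.mul_apply, map_sum,
    braidAt_zero_cons, firstShuffle, Finset.smul_sum]
  congr 1
  rw [Finset.sum_comm]
  refine Finset.sum_congr rfl fun u _ => Finset.sum_congr rfl fun m _ => ?_
  congr 2
  exact consPart_prod_braidAt r (n + 1) _ _ _

lemma toFree_succ (n : ℕ) (f : TPow K ι (n + 1)) :
    toFree K ι (n + 1) f =
      ∑ k, FreeAlgebra.ι K k * toFree K ι n (consPart K n k f) := by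
  simp only [toFree, Fintype.linearCombination_apply, Finset.mul_sum, consPart_apply]
  rw [← Fintype.sum_prod_type', ← (Fin.consEquiv fun _ : Fin (n + 1) => ι).sum_comp]
  refine Finset.sum_congr rfl fun x _ => ?_
  simp [Fin.consEquiv, List.ofFn_succ]

lemma toFree_zero (f : TPow K ι 0) : toFree K ι 0 f = algebraMap K _ (f Fin.elim0) := by
  simp only [toFree, Fintype.linearCombination_apply, Finset.univ_unique, Finset.sum_singleton]
  simp [Algebra.algebraMap_eq_smul_one]
  congr

lemma quantumSymmetrizer_zero (r : Matrix (ι × ι) (ι × ι) K) : quantumSymmetrizer r 0 = 1 := by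
  simp [quantumSymmetrizer, matsumoto, reducedWord]

lemma quantumSymmetrizer_one (r : Matrix (ι × ι) (ι × ι) K) : quantumSymmetrizer r 1 = 1 := by
  have (f : TPow K ι 1) (k : ι) :
      consPart K 0 k (quantumSymmetrizer r 1 f) = consPart K 0 k f := by
    rw [consPart_quantumSymmetrizer, firstShuffle_one, quantumSymmetrizer_zero]
    rfl
  refine LinearMap.ext fun f => funext fun w => ?_
  have h := congrFun (this f (w 0)) (Fin.tail w)
  simpa [consPart_apply] using h

end Symmetrizer

/-! ### Skew derivations detect the defining relations -/

section SkewDerivations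

variable {K : Type*} [Field K] {ι : Type*} [Fintype ι] [DecidableEq ι]
variable {A : Type*} [Ring A] [Algebra K A]

/-- The skew derivations `d k` on an algebra with counit `ε` that is generated by the `x i`,
with respect to a braiding of the span of the `x i`. -/
structure SkewDerivations (r : Matrix (ι × ι) (ι × ι) K) (x : ι → A) (d : ι → A →ₗ[K] A)
    (ε : A →ₐ[K] K) : Prop where
  map_one : ∀ k, d k 1 = 0
  map_gen_mul : ∀ k j y, d k (x j * y) =
    (if j = k then y else 0) + ∑ l, ∑ i, r (k, l) (j, i) • (x l * d i y)
  counit_gen : ∀ j, ε (x j) = 0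

/-- The functional `ε ∘ d k_n ∘ ⋯ ∘ d k_1`. -/
def iterDer (d : ι → A →ₗ[K] A) (ε : A →ₐ[K] K) : List ι → A →ₗ[K] K
  | [] => ε.toLinearMap
  | k :: w => (iterDer d ε w).comp (d k)

variable {r : Matrix (ι × ι) (ι × ι) K} {x : ι → A} {d : ι → A →ₗ[K] A} {ε : A →ₐ[K] K}

/-- Both sides obey the same recursion in the first tensor factor: `map_gen_mul` on the left,
`firstShuffle_succ` on the right. -/
lemma SkewDerivations.map_toFree (h : SkewDerivations r x d ε) (n : ℕ) (k : ι)
    (f : TPow K ι (n + 1)) :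
    d k (FreeAlgebra.lift K x (toFree K ι (n + 1) f)) =
      FreeAlgebra.lift K x (toFree K ι n (consPart K n k (firstShuffle r (n + 1) f))) := by
  induction n generalizing k with
  | zero =>
    rw [toFree_succ, map_sum, map_sum, show firstShuffle r (0 + 1) = 1 from firstShuffle_one r]
    simp only [toFree_zero, map_mul, FreeAlgebra.lift_ι_apply, h.map_gen_mul,
      Algebra.algebraMap_eq_smul_one, map_smul]
    simp [h.map_one]
  | succ n ih =>
    rw [toFree_succ (n + 1), map_sum, map_sum]
    simp only [map_mul, FreeAlgebra.lift_ι_apply, h.map_gen_mul, ih, Finset.sum_add_distrib]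
    rw [Finset.sum_ite_eq' Finset.univ k, if_pos (Finset.mem_univ k), toFree_succ n,
      toFree_succ n, map_sum, map_sum]
    simp only [map_mul, FreeAlgebra.lift_ι_apply, firstShuffle_succ, map_add, map_sum, mul_add,
      Finset.sum_add_distrib, map_smul]
    congr 1
    rw [Finset.sum_comm]
    refine Finset.sum_congr rfl fun l _ => ?_
    rw [Fintype.sum_prod_type, Finset.mul_sum]
    refine Finset.sum_congr rfl fun j _ => ?_
    rw [Finset.mul_sum]
    refine Finset.sum_congr rfl fun i _ => ?_
    rw [mul_smul_comm]

lemma SkewDerivations.iterDer_toFree (h : SkewDerivations r x d ε) (n : ℕ) (f : TPow K ι n)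
    (w : Fin n → ι) :
    iterDer d ε (List.ofFn w) (FreeAlgebra.lift K x (toFree K ι n f)) =
      quantumSymmetrizer r n f w := by
  induction n with
  | zero =>
    rw [Subsingleton.elim w Fin.elim0]
    simp [iterDer, toFree_zero, quantumSymmetrizer_zero]
  | succ n ih =>
    rw [List.ofFn_succ]
    simp only [iterDer, LinearMap.comp_apply, h.map_toFree]
    have := ih (consPart K n (w 0) (firstShuffle r (n + 1) f)) (Fin.tail w)
    rw [← consPart_quantumSymmetrizer, consPart_apply, Fin.cons_self_tail] at this
    exact this

/-- Each derivation lowers the degree by one; too short a word leaves positive degree, killed by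
`ε`, and too long a word reaches `d k 1 = 0`. -/
lemma SkewDerivations.iterDer_toFree_of_ne (h : SkewDerivations r x d ε) (n : ℕ)
    (f : TPow K ι n) (w : List ι) (hw : w.length ≠ n) :
    iterDer d ε w (FreeAlgebra.lift K x (toFree K ι n f)) = 0 := by
  induction w generalizing n with
  | nil =>
    obtain ⟨n, rfl⟩ := Nat.exists_eq_succ_of_ne_zero (Ne.symm hw)
    simp [iterDer, toFree_succ, h.counit_gen]
  | cons k w ih =>
    cases n with
    | zero =>
      simp [iterDer, toFree_zero, Algebra.algebraMap_eq_smul_one, h.map_one]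
    | succ n =>
      simp only [iterDer, LinearMap.comp_apply, h.map_toFree]
      exact ih n _ (by simpa using hw)

/-- A subspace of an algebra that contains `1` and is stable under left multiplication by
generators is everything. -/
lemma eq_top_of_gen_mul_mem (hx : Function.Surjective (FreeAlgebra.lift K x))
    (S : Submodule K A) (h1 : (1 : A) ∈ S) (hmul : ∀ j, ∀ y ∈ S, x j * y ∈ S) : S = ⊤ := by
  have key : ∀ u : FreeAlgebra K ι, ∀ y ∈ S, FreeAlgebra.lift K x u * y ∈ S := by
    intro u
    induction u using FreeAlgebra.induction with
    | grade0 c =>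
      intro y hy
      rw [AlgHom.commutes, ← Algebra.smul_def]
      exact S.smul_mem _ hy
    | grade1 j =>
      intro y hy
      simpa using hmul j y hy
    | mul u v hu hv =>
      intro y hy
      rw [map_mul, mul_assoc]
      exact hu _ (hv _ hy)
    | add u v hu hv =>
      intro y hy
      rw [map_add, add_mul]
      exact S.add_mem (hu _ hy) (hv _ hy)
  rw [eq_top_iff]
  rintro y -
  obtain ⟨u, rfl⟩ := hx y
  simpa using key u 1 h1

lemma iSup_range_toFree : ⨆ n, LinearMap.range (toFree K ι n) = ⊤ := by
  refine eq_top_of_gen_mul_mem (x := FreeAlgebra.ι K) ?_ _ ?_ ?_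
  · have h : FreeAlgebra.lift K (FreeAlgebra.ι K (X := ι)) = AlgHom.id K _ :=
      FreeAlgebra.hom_ext (by ext; simp)
    exact fun y => ⟨y, by rw [h]; rfl⟩
  · refine Submodule.mem_iSup_of_mem 0 ⟨fun _ => 1, ?_⟩
    simp [toFree_zero]
  · intro j y hy
    induction hy using Submodule.iSup_induction' with
    | mem n y hy =>
      obtain ⟨f, rfl⟩ := hy
      refine Submodule.mem_iSup_of_mem (n + 1)
        ⟨fun w => if w 0 = j then f (Fin.tail w) else 0, ?_⟩
      rw [toFree_succ, Finset.sum_eq_single j]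
      · congr 2
        funext w
        simp
      · intro k _ hk
        have : consPart K n k (fun w => if w 0 = j then f (Fin.tail w) else 0) = 0 := by
          funext w
          simp [hk]
        rw [this, map_zero, mul_zero]
      · simp
    | zero => simp
    | add y z _ _ hy hz =>
      rw [mul_add]
      exact Submodule.add_mem _ hy hz

/-- The defining relations of the Nichols algebra are those of any algebra with skew derivations
whose iterates separate points. -/
theorem SkewDerivations.mem_defRel_iff (h : SkewDerivations r x d ε)
    (hsep : ∀ u, (∀ w, iterDer d ε w u = 0) → u = 0) (y : FreeAlgebra K ι) :
    y ∈ defRel r ↔ FreeAlgebra.lift K x y = 0 := by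
  constructor
  · intro hy
    suffices defRel r ≤ LinearMap.ker (FreeAlgebra.lift K x).toLinearMap from this hy
    refine iSup₂_le fun n _ => ?_
    rintro _ ⟨f, hf, rfl⟩
    refine hsep _ fun w => ?_
    by_cases hw : w.length = n
    · subst hw
      have := h.iterDer_toFree w.length f w.get
      rw [List.ofFn_get, show quantumSymmetrizer r w.length f = 0 from hf] at this
      exact this
    · exact h.iterDer_toFree_of_ne n f w hw
  · intro hy
    have hy' : y ∈ ⨆ n, LinearMap.range (toFree K ι n) := by
      rw [iSup_range_toFree]
      trivial
    obtain ⟨g, hg, hsum⟩ := (Submodule.mem_iSup_iff_exists_finsupp _ _).1 hy'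
    choose f hf using hg
    -- Words of length `n` see only the component of degree `n`, so each homogeneous component is
    -- treated separately.
    have hQ (n : ℕ) : quantumSymmetrizer r n (f n) = 0 := by
      funext w
      have h1 : iterDer d ε (List.ofFn w) (FreeAlgebra.lift K x y) = 0 := by rw [hy, map_zero]
      rw [← hsum, Finsupp.sum, map_sum, map_sum, Finset.sum_eq_single n] at h1
      · rwa [← hf, h.iterDer_toFree] at h1
      · intro m _ hm
        rw [← hf]
        exact h.iterDer_toFree_of_ne _ _ _ (by simpa using hm.symm)
      · intro hn
        rw [Finsupp.notMem_support_iff.1 hn, map_zero, map_zero]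
    rw [← hsum]
    refine Submodule.sum_mem _ fun n _ => ?_
    by_cases hn : 2 ≤ n
    · exact Submodule.mem_iSup_of_mem n (Submodule.mem_iSup_of_mem hn ⟨f n, hQ n, hf n⟩)
    -- In degrees 0 and 1 the symmetrizer is the identity, so nothing is lost by starting $\mathcal
    -- J(V)$ at degree 2.
    · have h0 : f n = 0 := by
        have := hQ n
        interval_cases n
        · rwa [quantumSymmetrizer_zero] at this
        · rwa [quantumSymmetrizer_one] at this
      dsimp only
      rw [← hf, h0, map_zero]
      exact Submodule.zero_mem _

end SkewDerivations

/-! ### Constructing skew derivations on a quotient -/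

section SkewOperators

variable {K : Type*} [Field K] {ι : Type*} [Fintype ι] [DecidableEq ι]
variable {A : Type*} [Ring A] [Algebra K A]

/-- The operator on pairs `(y, (d_i y)_i)` induced by left multiplication by `x_j` on `y`. -/
def skewOp (r : Matrix (ι × ι) (ι × ι) K) (x : ι → A) (j : ι) : Module.End K (A × (ι → A)) where
  toFun v := (x j * v.1,
    fun k => (if j = k then v.1 else 0) + ∑ l, ∑ i, r (k, l) (j, i) • (x l * v.2 i))
  map_add' v w := by
    refine Prod.ext (mul_add _ _ _) (funext fun k => ?_)
    simp only [Prod.fst_add, Prod.snd_add, Pi.add_apply, mul_add, smul_add,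
      Finset.sum_add_distrib]
    split_ifs <;> abel
  map_smul' c v := by
    refine Prod.ext (by simp) (funext fun k => ?_)
    simp [Finset.smul_sum, smul_comm c]

lemma skewOp_apply (r : Matrix (ι × ι) (ι × ι) K) (x : ι → A) (j : ι) (v : A × (ι → A)) :
    skewOp r x j v = (x j * v.1,
      fun k => (if j = k then v.1 else 0) + ∑ l, ∑ i, r (k, l) (j, i) • (x l * v.2 i)) := rfl

/-- If the operators `skewOp` satisfy the relations of an algebra, then the algebra has skew
derivations. -/
lemma exists_skewDerivations (r : Matrix (ι × ι) (ι × ι) K) (I : TwoSidedIdeal (FreeAlgebra K ι))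
    (h : ∀ u ∈ I, FreeAlgebra.lift K
      (skewOp r fun i => Ideal.Quotient.mk I.asIdeal (FreeAlgebra.ι K i)) u = 0)
    (hε : ∀ u ∈ I, FreeAlgebra.lift K (fun _ => (0 : K)) u = 0) :
    ∃ d ε, SkewDerivations r (fun i => Ideal.Quotient.mk I.asIdeal (FreeAlgebra.ι K i)) d ε := by
  set x := fun i => Ideal.Quotient.mk I.asIdeal (FreeAlgebra.ι K i) with hx
  let Φ : (FreeAlgebra K ι ⧸ I.asIdeal) →ₐ[K] Module.End K (_ × (ι → _)) :=
    Ideal.Quotient.liftₐ I.asIdeal (FreeAlgebra.lift K (skewOp r x))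
      fun u hu => h u (TwoSidedIdeal.mem_asIdeal.1 hu)
  let ε : (FreeAlgebra K ι ⧸ I.asIdeal) →ₐ[K] K :=
    Ideal.Quotient.liftₐ I.asIdeal (FreeAlgebra.lift K fun _ => (0 : K))
      fun u hu => hε u (TwoSidedIdeal.mem_asIdeal.1 hu)
  have hΦ (j : ι) : Φ (x j) = skewOp r x j :=
    FreeAlgebra.lift_ι_apply (R := K) (skewOp r x) j
  have hfst : ∀ y v, (Φ y v).1 = y * v.1 := by
    intro y
    obtain ⟨u, rfl⟩ := Ideal.Quotient.mk_surjective y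
    have hmk (u) : Φ (Ideal.Quotient.mk I.asIdeal u) = FreeAlgebra.lift K (skewOp r x) u := rfl
    simp only [hmk]
    induction u using FreeAlgebra.induction with
    | grade0 c =>
      intro v
      rw [AlgHom.commutes]
      simp only [Module.algebraMap_end_apply, Prod.smul_fst]
      rw [Algebra.smul_def]
      rfl
    | grade1 j =>
      intro v
      rw [FreeAlgebra.lift_ι_apply]
      rfl
    | mul u w hu hw =>
      intro v
      rw [map_mul, Module.End.mul_apply, hu, hw, map_mul, mul_assoc]
    | add u w hu hw =>
      intro v
      rw [map_add, LinearMap.add_apply, Prod.fst_add, hu, hw, map_add, add_mul]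
  -- The starting vector `(1, 0)` records that `1` has zero derivatives; acting on it by `y`
  -- produces `y` together with its derivatives.
  refine ⟨fun k => (LinearMap.proj k).comp ((LinearMap.snd K _ _).comp
    ((LinearMap.applyₗ (1, 0)).comp Φ.toLinearMap)), ε, ?_, ?_, ?_⟩
  · intro k
    simp
  · intro k j y
    simp only [LinearMap.comp_apply, AlgHom.toLinearMap_apply, map_mul, hΦ,
      LinearMap.applyₗ_apply_apply, Module.End.mul_apply, skewOp_apply, hfst, mul_one,
      LinearMap.snd_apply, LinearMap.proj_apply]
  · intro j
    exact FreeAlgebra.lift_ι_apply (R := K) (fun _ => (0 : K)) j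

end SkewOperators

/-! ### The braiding at $t=-1$, $p=0$ and its compatibility with the relations -/

section Braiding

variable {K : Type*} [Field K] {A : Type*} [Ring A] [Algebra K A]

/-- The relations that hold in the Nichols algebra of `R_{1,5}` with `t = -1` and `p = 0`, as
rules that rewrite to ordered monomials. -/
structure QuadraticRelations (ℓ q : K) (x : Fin 3 → A) : Prop where
  x00 : x 0 * x 0 = 0
  x10 : x 1 * x 0 = -(x 0 * x 1)
  x11 : x 1 * x 1 = ℓ • (x 0 * x 1)
  x20 : x 2 * x 0 = -(x 0 * x 2)
  x21 : x 2 * x 1 = -(x 1 * x 2) + ℓ • (x 0 * x 2) - q • (x 0 * x 1)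

namespace QuadraticRelations

variable {ℓ q : K} {x : Fin 3 → A} (h : QuadraticRelations ℓ q x)
include h

lemma x00' (y : A) : x 0 * (x 0 * y) = 0 := by rw [← mul_assoc, h.x00, zero_mul]

lemma x10' (y : A) : x 1 * (x 0 * y) = -(x 0 * (x 1 * y)) := by
  rw [← mul_assoc, h.x10, neg_mul, mul_assoc]

lemma x11' (y : A) : x 1 * (x 1 * y) = ℓ • (x 0 * (x 1 * y)) := by
  rw [← mul_assoc, h.x11, smul_mul_assoc, mul_assoc]

lemma x20' (y : A) : x 2 * (x 0 * y) = -(x 0 * (x 2 * y)) := by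
  rw [← mul_assoc, h.x20, neg_mul, mul_assoc]

lemma x21' (y : A) : x 2 * (x 1 * y) =
    -(x 1 * (x 2 * y)) + ℓ • (x 0 * (x 2 * y)) - q • (x 0 * (x 1 * y)) := by
  rw [← mul_assoc, h.x21]
  simp only [sub_mul, add_mul, neg_mul, smul_mul_assoc, mul_assoc]

end QuadraticRelations

lemma skewOp_braiding15_zero (a b k ℓ q : K) (x : Fin 3 → A) (v : A × (Fin 3 → A)) :
    skewOp (braiding15 (-1) 0 a b k ℓ q) x 0 v =
      (x 0 * v.1, ![v.1 - x 0 * v.2 0 + ℓ • (x 0 * v.2 1), -(x 0 * v.2 1), -(x 0 * v.2 2)]) := by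
  rw [skewOp_apply]
  refine Prod.ext rfl (funext fun i => ?_)
  fin_cases i <;>
  · simp [Fin.sum_univ_three, braiding15, R15, finProdFinEquiv]
    try module

lemma skewOp_braiding15_one (a b k ℓ q : K) (x : Fin 3 → A) (v : A × (Fin 3 → A)) :
    skewOp (braiding15 (-1) 0 a b k ℓ q) x 1 v =
      (x 1 * v.1,
        ![-(x 1 * v.2 0) - ℓ • (x 0 * v.2 0) + ℓ • (x 1 * v.2 1) + ℓ ^ 2 • (x 0 * v.2 1)
            - q • (x 1 * v.2 2) - k • (x 0 * v.2 2),
          v.1 - x 1 * v.2 1 - ℓ • (x 0 * v.2 1) + q • (x 0 * v.2 2),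
          -(x 1 * v.2 2) - ℓ • (x 0 * v.2 2)]) := by
  rw [skewOp_apply]
  refine Prod.ext rfl (funext fun i => ?_)
  fin_cases i <;>
  · simp [Fin.sum_univ_three, braiding15, R15, finProdFinEquiv]
    try module

lemma skewOp_braiding15_two (a b k ℓ q : K) (x : Fin 3 → A) (v : A × (Fin 3 → A)) :
    skewOp (braiding15 (-1) 0 a b k ℓ q) x 2 v =
      (x 2 * v.1,
        ![-(x 2 * v.2 0) + ℓ • (x 2 * v.2 1) - (ℓ * q - k) • (x 0 * v.2 1)
            - b • (x 1 * v.2 2) - a • (x 0 * v.2 2),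
          -(x 2 * v.2 1) + b • (x 0 * v.2 2),
          v.1 - x 2 * v.2 2]) := by
  rw [skewOp_apply]
  refine Prod.ext rfl (funext fun i => ?_)
  fin_cases i <;>
  · simp [Fin.sum_univ_three, braiding15, R15, finProdFinEquiv]
    try module

section

variable {ℓ q : K} {x : Fin 3 → A} (h : QuadraticRelations ℓ q x) (a b k : K)
include h

/-- The operators `skewOp` satisfy the quadratic relations. -/
lemma QuadraticRelations.skewOp :
    QuadraticRelations ℓ q (skewOp (braiding15 (-1) 0 a b k ℓ q) x) := by
  constructor <;> refine LinearMap.ext fun v => Prod.ext ?_ (funext fun i => ?_)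
  all_goals
    try fin_cases i
  all_goals
    simp [skewOp_braiding15_zero, skewOp_braiding15_one, skewOp_braiding15_two, mul_add, mul_sub,
      h.x00', h.x10', h.x11', h.x20', h.x21']
    try module

/-- The obstruction to imposing $z=0$ is the term $(b\ell-a)x_1$ in the `d 0`-component, which `hab`
removes; the other terms cancel after rewriting to ordered form. -/
lemma QuadraticRelations.skewOp_two_mul_two (hx : x 2 * x 2 = -(b • (x 0 * x 1)))
    (hab : a = b * ℓ) :
    NicholsRankThree.skewOp (braiding15 (-1) 0 a b k ℓ q) x 2 *
        NicholsRankThree.skewOp (braiding15 (-1) 0 a b k ℓ q) x 2 =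
      -(b • (NicholsRankThree.skewOp (braiding15 (-1) 0 a b k ℓ q) x 0 *
        NicholsRankThree.skewOp (braiding15 (-1) 0 a b k ℓ q) x 1)) := by
  have hx' (y : A) : x 2 * (x 2 * y) = -(b • (x 0 * (x 1 * y))) := by
    rw [← mul_assoc, hx, neg_mul, smul_mul_assoc, mul_assoc]
  subst hab
  refine LinearMap.ext fun v => Prod.ext ?_ (funext fun i => ?_)
  all_goals
    try fin_cases i
  all_goals
    simp [skewOp_braiding15_zero, skewOp_braiding15_one, skewOp_braiding15_two, mul_add, mul_sub,
      h.x00', h.x20', h.x21', hx']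
    try module

end

end Braiding

/-! ### Separation by the derivations, via $z=x_3^2+b\,x_1x_2$ -/

section Separation

open Polynomial

variable {K : Type*} [Field K] {A : Type*} [Ring A] [Algebra K A]
variable {a b k ℓ q : K} {x : Fin 3 → A} {d : Fin 3 → A →ₗ[K] A} {ε : A →ₐ[K] K}

section Rules

variable (hd : SkewDerivations (braiding15 (-1) 0 a b k ℓ q) x d ε)
include hd

lemma SkewDerivations.map_mul_eq_skewOp (j i : Fin 3) (y : A) :
    d i (x j * y) = (skewOp (braiding15 (-1) 0 a b k ℓ q) x j (y, fun i => d i y)).2 i :=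
  hd.map_gen_mul i j y

lemma SkewDerivations.d00 (y : A) :
    d 0 (x 0 * y) = y - x 0 * d 0 y + ℓ • (x 0 * d 1 y) := by
  rw [hd.map_mul_eq_skewOp, skewOp_braiding15_zero]; rfl

lemma SkewDerivations.d10 (y : A) : d 1 (x 0 * y) = -(x 0 * d 1 y) := by
  rw [hd.map_mul_eq_skewOp, skewOp_braiding15_zero]; rfl

lemma SkewDerivations.d20 (y : A) : d 2 (x 0 * y) = -(x 0 * d 2 y) := by
  rw [hd.map_mul_eq_skewOp, skewOp_braiding15_zero]; rfl

lemma SkewDerivations.d01 (y : A) :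
    d 0 (x 1 * y) = -(x 1 * d 0 y) - ℓ • (x 0 * d 0 y) + ℓ • (x 1 * d 1 y)
      + ℓ ^ 2 • (x 0 * d 1 y) - q • (x 1 * d 2 y) - k • (x 0 * d 2 y) := by
  rw [hd.map_mul_eq_skewOp, skewOp_braiding15_one]; rfl

lemma SkewDerivations.d11 (y : A) :
    d 1 (x 1 * y) = y - x 1 * d 1 y - ℓ • (x 0 * d 1 y) + q • (x 0 * d 2 y) := by
  rw [hd.map_mul_eq_skewOp, skewOp_braiding15_one]; rfl

lemma SkewDerivations.d21 (y : A) :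
    d 2 (x 1 * y) = -(x 1 * d 2 y) - ℓ • (x 0 * d 2 y) := by
  rw [hd.map_mul_eq_skewOp, skewOp_braiding15_one]; rfl

lemma SkewDerivations.d02 (y : A) :
    d 0 (x 2 * y) = -(x 2 * d 0 y) + ℓ • (x 2 * d 1 y) - (ℓ * q - k) • (x 0 * d 1 y)
      - b • (x 1 * d 2 y) - a • (x 0 * d 2 y) := by
  rw [hd.map_mul_eq_skewOp, skewOp_braiding15_two]; rfl

lemma SkewDerivations.d12 (y : A) :
    d 1 (x 2 * y) = -(x 2 * d 1 y) + b • (x 0 * d 2 y) := by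
  rw [hd.map_mul_eq_skewOp, skewOp_braiding15_two]; rfl

lemma SkewDerivations.d22 (y : A) : d 2 (x 2 * y) = y - x 2 * d 2 y := by
  rw [hd.map_mul_eq_skewOp, skewOp_braiding15_two]; rfl

end Rules

/-- The element `x_3^2 + b x_1 x_2`. -/
def zElt (b : K) (x : Fin 3 → A) : A := x 2 * x 2 + b • (x 0 * x 1)

lemma zElt_mul (b : K) (x : Fin 3 → A) (y : A) :
    zElt b x * y = x 2 * (x 2 * y) + b • (x 0 * (x 1 * y)) := by
  simp [zElt, add_mul, mul_assoc]

section Elimination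

variable (h : QuadraticRelations ℓ q x)
  (hd : SkewDerivations (braiding15 (-1) 0 a b k ℓ q) x d ε)
include h

lemma QuadraticRelations.zElt_mul_zero (y : A) :
    zElt b x * (x 0 * y) = x 0 * (zElt b x * y) := by
  simp [zElt_mul, mul_add, h.x00', h.x10', h.x20']

include hd

/-- This is the source of the scalar $b\ell-a$ that divides the two cases of the theorem. -/
lemma SkewDerivations.d0_zElt_mul (y : A) :
    d 0 (zElt b x * y) =
      (b * ℓ - a) • (x 0 * y) + zElt b x * d 0 y - (2 * ℓ) • (zElt b x * d 1 y) := by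
  simp [zElt_mul, hd.d00, hd.d01, hd.d11, hd.d02, hd.d12, hd.d22, mul_add, mul_sub,
    h.x00', h.x20', h.x21']
  module

lemma SkewDerivations.d1_zElt_mul (y : A) : d 1 (zElt b x * y) = zElt b x * d 1 y := by
  simp [zElt_mul, hd.d10, hd.d11, hd.d12, hd.d22, mul_add, mul_sub, h.x00', h.x20']
  try module

lemma SkewDerivations.d2_zElt_mul (y : A) : d 2 (zElt b x * y) = zElt b x * d 2 y := by
  simp [zElt_mul, hd.d20, hd.d21, hd.d22, mul_sub, h.x00']
  try module

lemma SkewDerivations.d2_aeval (P : K[X]) : d 2 (aeval (zElt b x) P) = 0 := by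
  induction P using Polynomial.induction_on with
  | C c => simp [Algebra.algebraMap_eq_smul_one, hd.map_one]
  | add P Q hP hQ => simp [hP, hQ]
  | monomial n c ih =>
    rw [pow_succ', mul_left_comm, map_mul, aeval_X, hd.d2_zElt_mul h, ih, mul_zero]

lemma SkewDerivations.d1_aeval (P : K[X]) : d 1 (aeval (zElt b x) P) = 0 := by
  induction P using Polynomial.induction_on with
  | C c => simp [Algebra.algebraMap_eq_smul_one, hd.map_one]
  | add P Q hP hQ => simp [hP, hQ]
  | monomial n c ih =>
    rw [pow_succ', mul_left_comm, map_mul, aeval_X, hd.d1_zElt_mul h, ih, mul_zero]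

/-- The `d 1` term of `d0_zElt_mul` vanishes on polynomials in $z$, and $z$ moves past $x_1$, so
what remains is the product rule for the ordinary derivative. -/
lemma SkewDerivations.d0_aeval (P : K[X]) :
    d 0 (aeval (zElt b x) P) = (b * ℓ - a) • (x 0 * aeval (zElt b x) (derivative P)) := by
  induction P using Polynomial.induction_on with
  | C c => simp [Algebra.algebraMap_eq_smul_one, hd.map_one]
  | add P Q hP hQ => simp [hP, hQ, mul_add]
  | monomial n c ih =>
    rw [pow_succ', mul_left_comm]
    generalize C c * X ^ n = T at ih ⊢
    rw [map_mul, aeval_X, hd.d0_zElt_mul h, ih, hd.d1_aeval h,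
      derivative_mul (f := X), derivative_X, one_mul, map_add, map_mul, aeval_X, mul_add, smul_add,
      mul_smul_comm, h.zElt_mul_zero, mul_zero, smul_zero, sub_zero]

omit h in
lemma SkewDerivations.counit_aeval (P : K[X]) : ε (aeval (zElt b x) P) = P.coeff 0 := by
  rw [← Polynomial.aeval_algHom_apply]
  have : ε (zElt b x) = 0 := by simp [zElt, hd.counit_gen]
  rw [this, Polynomial.coeff_zero_eq_aeval_zero]

/-- If all iterated derivations of `P(z) + x_1 Q(z)` have constant term zero, then `P = Q = 0`.
The degrees are bounded by `n`, where `n = 0` is assumed if the derivations kill `z`. -/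
lemma SkewDerivations.elim_one [CharZero K] (n : ℕ) (hn : n = 0 ∨ b * ℓ - a ≠ 0) (P Q : K[X])
    (hP : P.natDegree ≤ n) (hQ : Q.natDegree ≤ n)
    (hu : ∀ w, iterDer d ε w (aeval (zElt b x) P + x 0 * aeval (zElt b x) Q) = 0) :
    P = 0 ∧ Q = 0 := by
  -- On pairs, `d 0` acts by $(R,S)\mapsto(S,\delta R')$ with $\delta=b\ell-a$; its square
  -- differentiates both entries up to $\delta$.
  have h0 : ∀ R S : K[X], d 0 (aeval (zElt b x) R + x 0 * aeval (zElt b x) S) =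
      aeval (zElt b x) S + x 0 * aeval (zElt b x) ((b * ℓ - a) • derivative R) := by
    intro R S
    rw [map_add, hd.d00, hd.d0_aeval h, hd.d0_aeval h, hd.d1_aeval h, mul_smul_comm, h.x00',
      mul_zero, smul_zero, smul_zero, map_smul, mul_smul_comm]
    abel
  have hε : ∀ R S : K[X], ε (aeval (zElt b x) R + x 0 * aeval (zElt b x) S) = R.coeff 0 := by
    intro R S
    rw [map_add, map_mul, hd.counit_gen, zero_mul, add_zero, hd.counit_aeval]
  have hcoeff : ∀ R S : K[X],
      (∀ w, iterDer d ε w (aeval (zElt b x) R + x 0 * aeval (zElt b x) S) = 0) →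
      R.coeff 0 = 0 ∧ S.coeff 0 = 0 := by
    intro R S hRS
    constructor
    · rw [← hε R S]; exact hRS []
    · rw [← hε S ((b * ℓ - a) • derivative R), ← h0]; exact hRS [0]
  induction n generalizing P Q with
  | zero =>
    rw [eq_C_of_natDegree_le_zero hP, eq_C_of_natDegree_le_zero hQ, (hcoeff P Q hu).1,
      (hcoeff P Q hu).2]
    simp
  | succ n ih =>
    have hne : b * ℓ - a ≠ 0 := hn.resolve_left (by omega)
    have hu' : ∀ w, iterDer d ε w (aeval (zElt b x) ((b * ℓ - a) • derivative P) +
        x 0 * aeval (zElt b x) ((b * ℓ - a) • derivative Q)) = 0 := by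
      intro w
      rw [← h0, ← h0]
      exact hu (0 :: 0 :: w)
    have key := ih (Or.inr hne) _ _ ?_ ?_ hu'
    -- Characteristic zero enters here: vanishing derivatives leave constants, and `hcoeff` shows
    -- that these are zero.
    · simp only [smul_eq_zero, hne, false_or, derivative_eq_zero] at key
      rw [eq_C_of_natDegree_eq_zero key.1, eq_C_of_natDegree_eq_zero key.2, (hcoeff P Q hu).1,
        (hcoeff P Q hu).2]
      simp
    · exact (natDegree_smul_le _ _).trans ((natDegree_derivative_le P).trans (by omega))
    · exact (natDegree_smul_le _ _).trans ((natDegree_derivative_le Q).trans (by omega))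

/-- The polynomials in `z` that are needed for a basis: all of them if the derivations do not
kill `z`, and the constants otherwise. -/
def admissible (δ : K) : Submodule K K[X] where
  carrier := {P | P.natDegree = 0 ∨ δ ≠ 0}
  add_mem' {P Q} hP hQ := by
    rcases hP with hP | hP
    · rcases hQ with hQ | hQ
      · exact Or.inl (Nat.le_zero.1 ((natDegree_add_le P Q).trans (by simp [hP, hQ])))
      · exact Or.inr hQ
    · exact Or.inr hP
  zero_mem' := Or.inl natDegree_zero
  smul_mem' c P hP := hP.imp_left fun h => Nat.le_zero.1 ((natDegree_smul_le c P).trans h.le)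

/-- Applying `d 1` kills the terms without $x_2$ and leaves $R(z)-x_1S(z)$, so `elim_one` disposes
of `R` and `S`, and then of `P` and `Q`. -/
lemma SkewDerivations.elim_two [CharZero K] {P Q R S : K[X]}
    (hP : P ∈ admissible (b * ℓ - a)) (hQ : Q ∈ admissible (b * ℓ - a))
    (hR : R ∈ admissible (b * ℓ - a)) (hS : S ∈ admissible (b * ℓ - a))
    (hu : ∀ w, iterDer d ε w (aeval (zElt b x) P + x 0 * aeval (zElt b x) Q +
      x 1 * aeval (zElt b x) R + x 0 * (x 1 * aeval (zElt b x) S)) = 0) :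
    P = 0 ∧ Q = 0 ∧ R = 0 ∧ S = 0 := by
  have base : ∀ {P Q : K[X]}, P ∈ admissible (b * ℓ - a) → Q ∈ admissible (b * ℓ - a) →
      (∀ w, iterDer d ε w (aeval (zElt b x) P + x 0 * aeval (zElt b x) Q) = 0) →
      P = 0 ∧ Q = 0 := by
    intro P Q hP hQ hu
    refine hd.elim_one h (max P.natDegree Q.natDegree) ?_ P Q (le_max_left _ _)
      (le_max_right _ _) hu
    rcases hP with hP | hP
    · rcases hQ with hQ | hQ
      · left; simp [hP, hQ]
      · exact Or.inr hQ
    · exact Or.inr hP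
  have h1 : d 1 (aeval (zElt b x) P + x 0 * aeval (zElt b x) Q +
      x 1 * aeval (zElt b x) R + x 0 * (x 1 * aeval (zElt b x) S)) =
      aeval (zElt b x) R + x 0 * aeval (zElt b x) (-S) := by
    simp [hd.d10, hd.d11, hd.d1_aeval h, hd.d2_aeval h]
  obtain ⟨rfl, hS0⟩ := base hR (Submodule.neg_mem _ hS) fun w => by
    rw [← h1]
    exact hu (1 :: w)
  obtain rfl : S = 0 := neg_eq_zero.1 hS0
  obtain ⟨rfl, rfl⟩ := base hP hQ fun w => by simpa using hu w
  exact ⟨rfl, rfl, rfl, rfl⟩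

/-- The elements `x_1^i x_2^j x_3^c P(z)` with `i, j, c < 2` are separated by the iterated
derivations. -/
lemma SkewDerivations.elim_three [CharZero K] {P Q R S P' Q' R' S' : K[X]}
    (hP : P ∈ admissible (b * ℓ - a)) (hQ : Q ∈ admissible (b * ℓ - a))
    (hR : R ∈ admissible (b * ℓ - a)) (hS : S ∈ admissible (b * ℓ - a))
    (hP' : P' ∈ admissible (b * ℓ - a)) (hQ' : Q' ∈ admissible (b * ℓ - a))
    (hR' : R' ∈ admissible (b * ℓ - a)) (hS' : S' ∈ admissible (b * ℓ - a))
    (hu : ∀ w, iterDer d ε w ((aeval (zElt b x) P + x 0 * aeval (zElt b x) Q +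
      x 1 * aeval (zElt b x) R + x 0 * (x 1 * aeval (zElt b x) S)) +
      (x 2 * aeval (zElt b x) P' + x 0 * (x 2 * aeval (zElt b x) Q') +
      x 1 * (x 2 * aeval (zElt b x) R') + x 0 * (x 1 * (x 2 * aeval (zElt b x) S')))) = 0) :
    (P = 0 ∧ Q = 0 ∧ R = 0 ∧ S = 0) ∧ P' = 0 ∧ Q' = 0 ∧ R' = 0 ∧ S' = 0 := by
  -- `d 2` kills the terms without $x_3$ and strips $x_3$ from the others; the coefficients change
  -- by an invertible triangular substitution.
  have h2 : d 2 ((aeval (zElt b x) P + x 0 * aeval (zElt b x) Q +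
      x 1 * aeval (zElt b x) R + x 0 * (x 1 * aeval (zElt b x) S)) +
      (x 2 * aeval (zElt b x) P' + x 0 * (x 2 * aeval (zElt b x) Q') +
      x 1 * (x 2 * aeval (zElt b x) R') + x 0 * (x 1 * (x 2 * aeval (zElt b x) S')))) =
      aeval (zElt b x) P' + x 0 * aeval (zElt b x) (-Q' - ℓ • R') +
      x 1 * aeval (zElt b x) (-R') + x 0 * (x 1 * aeval (zElt b x) S') := by
    simp [hd.d20, hd.d21, hd.d22, hd.d2_aeval h, mul_sub, h.x00']
    module
  obtain ⟨rfl, hQ0, hR0, rfl⟩ := hd.elim_two h hP'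
    (Submodule.sub_mem _ (Submodule.neg_mem _ hQ') (Submodule.smul_mem _ ℓ hR'))
    (Submodule.neg_mem _ hR') hS' fun w => by
      rw [← h2]
      exact hu (2 :: w)
  obtain rfl : R' = 0 := neg_eq_zero.1 hR0
  obtain rfl : Q' = 0 := by simpa using hQ0
  exact ⟨hd.elim_two h hP hQ hR hS fun w => by simpa using hu w, rfl, rfl, rfl, rfl⟩

end Elimination

/-! ### Passing from powers of $x_3$ to powers of $z$ -/

section PolynomialsInX

variable (h : QuadraticRelations ℓ q x)

lemma exists_even_odd (P : K[X]) :
    ∃ E O : K[X], P = expand K 2 E + X * expand K 2 O := by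
  induction P using Polynomial.induction_on with
  | C c => exact ⟨C c, 0, by simp⟩
  | add P Q hP hQ =>
    obtain ⟨E, O, rfl⟩ := hP
    obtain ⟨E', O', rfl⟩ := hQ
    exact ⟨E + E', O + O', by rw [map_add, map_add]; ring⟩
  | monomial n c ih =>
    obtain ⟨E, O, ih⟩ := ih
    exact ⟨X * O, E, by rw [pow_succ, ← mul_assoc, ih, map_mul, expand_X]; ring⟩

include h

/-- A Taylor expansion at $z$: $x_3^2=z-b\,x_1x_2$, where $x_1x_2$ commutes with $z$ and has square
zero. -/
lemma QuadraticRelations.aeval_sq (b : K) (E : K[X]) : aeval (x 2 * x 2) E =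
    aeval (zElt b x) E - b • (x 0 * (x 1 * aeval (zElt b x) (derivative E))) := by
  have hz (y : A) : zElt b x * (x 0 * (x 1 * y)) = x 0 * (x 1 * (zElt b x * y)) := by
    simp [zElt_mul, mul_add, mul_sub, h.x00', h.x10', h.x11', h.x20', h.x21']
  have hw : x 2 * x 2 = zElt b x - b • (x 0 * x 1) := by simp [zElt]
  induction E using Polynomial.induction_on with
  | C c => simp
  | add P Q hP hQ =>
    simp only [map_add, hP, hQ, mul_add, smul_add]
    abel
  | monomial n c ih =>
    rw [pow_succ', mul_left_comm]
    generalize C c * X ^ n = T at ih ⊢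
    rw [map_mul, aeval_X, ih, hw, derivative_mul (f := X), derivative_X, one_mul, map_add,
      map_mul, map_mul, aeval_X]
    simp only [sub_mul, mul_sub, mul_smul_comm, smul_mul_assoc, hz, mul_add, mul_assoc, h.x10',
      h.x00', mul_neg]
    module

/-- The Taylor correction is a multiple of $x_1x_2$, which $x_1$ and $x_2$ annihilate from the left.
Hence only the corrections from `P` survive, shifting `H` and `H'`. -/
lemma QuadraticRelations.ordered_sum_eq (b : K) (P Q R S E F G H E' F' G' H' : K[X])
    (hP : P = expand K 2 E + X * expand K 2 E') (hQ : Q = expand K 2 F + X * expand K 2 F')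
    (hR : R = expand K 2 G + X * expand K 2 G') (hS : S = expand K 2 H + X * expand K 2 H') :
    aeval (x 2) P + x 0 * aeval (x 2) Q + x 1 * aeval (x 2) R + x 0 * (x 1 * aeval (x 2) S) =
    (aeval (zElt b x) E + x 0 * aeval (zElt b x) F + x 1 * aeval (zElt b x) G +
      x 0 * (x 1 * aeval (zElt b x) (H - b • derivative E))) +
    (x 2 * aeval (zElt b x) E' + x 0 * (x 2 * aeval (zElt b x) F') +
      x 1 * (x 2 * aeval (zElt b x) G') +
      x 0 * (x 1 * (x 2 * aeval (zElt b x) (H' - b • derivative E')))) := by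
  subst hP hQ hR hS
  simp only [map_add, map_mul, aeval_X, expand_aeval, pow_two, h.aeval_sq b, mul_sub,
    mul_smul_comm, h.x00', h.x10', h.x11', h.x20', h.x21', mul_add, mul_neg, map_sub, map_smul,
    smul_zero, neg_zero, sub_zero, add_zero, neg_neg]
  module

/-- The ordered polynomials in `x_1, x_2, x_3` of degree at most one in `x_1` and `x_2` are
separated by the iterated derivations, if these do not kill `z`. -/
lemma SkewDerivations.elim_ordered [CharZero K]
    (hd : SkewDerivations (braiding15 (-1) 0 a b k ℓ q) x d ε) (hab : b * ℓ - a ≠ 0)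
    {P Q R S : K[X]}
    (hu : ∀ w, iterDer d ε w (aeval (x 2) P + x 0 * aeval (x 2) Q + x 1 * aeval (x 2) R +
      x 0 * (x 1 * aeval (x 2) S)) = 0) : P = 0 ∧ Q = 0 ∧ R = 0 ∧ S = 0 := by
  obtain ⟨E, E', hP⟩ := exists_even_odd P
  obtain ⟨F, F', hQ⟩ := exists_even_odd Q
  obtain ⟨G, G', hR⟩ := exists_even_odd R
  obtain ⟨H, H', hS⟩ := exists_even_odd S
  rw [h.ordered_sum_eq b P Q R S E F G H E' F' G' H' hP hQ hR hS] at hu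
  have hall (T : K[X]) : T ∈ admissible (b * ℓ - a) := Or.inr hab
  obtain ⟨⟨rfl, rfl, rfl, hH⟩, rfl, rfl, rfl, hH'⟩ := hd.elim_three h (hall _) (hall _) (hall _)
    (hall _) (hall _) (hall _) (hall _) (hall _) hu
  obtain rfl : H = 0 := by simpa using hH
  obtain rfl : H' = 0 := by simpa using hH'
  simp [hP, hQ, hR, hS]

end PolynomialsInX
end Separation

/-! ### Spanning by ordered monomials and growth bounds -/

section Spanning

variable {K : Type*} [Field K] {A : Type*} [Ring A] [Algebra K A]
variable {ℓ q : K} {x : Fin 3 → A} (h : QuadraticRelations ℓ q x)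

/-- The span of the monomials `x_1^i x_2^j x_3^m` with `i, j < 2` and `m ≤ N`. -/
def monomialSpan (K : Type*) [Field K] {A : Type*} [Ring A] [Algebra K A] (x : Fin 3 → A) (N : ℕ) :
    Submodule K A :=
  Submodule.span K (Set.range fun e : Fin 2 × Fin 2 × Fin (N + 1) =>
    x 0 ^ (e.1 : ℕ) * x 1 ^ (e.2.1 : ℕ) * x 2 ^ (e.2.2 : ℕ))

lemma monomial_mem_monomialSpan (x : Fin 3 → A) {N i j m : ℕ} (hi : i < 2) (hj : j < 2)
    (hm : m ≤ N) : x 0 ^ i * x 1 ^ j * x 2 ^ m ∈ monomialSpan K x N :=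
  Submodule.subset_span ⟨(⟨i, hi⟩, ⟨j, hj⟩, ⟨m, by omega⟩), rfl⟩

lemma one_mem_monomialSpan (x : Fin 3 → A) (N : ℕ) : 1 ∈ monomialSpan K x N := by
  simpa using monomial_mem_monomialSpan (K := K) x (N := N) (i := 0) (j := 0) (m := 0)
    (by omega) (by omega) (by omega)

lemma monomialSpan_mono (x : Fin 3 → A) : Monotone (monomialSpan K x) := by
  intro N M hNM
  refine Submodule.span_le.2 ?_
  rintro _ ⟨⟨i, j, m⟩, rfl⟩
  exact monomial_mem_monomialSpan x i.2 j.2 (by have := m.2; omega)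

instance (x : Fin 3 → A) (N : ℕ) : FiniteDimensional K (monomialSpan K x N) :=
  FiniteDimensional.span_of_finite K (Set.finite_range _)

lemma finrank_monomialSpan_le (x : Fin 3 → A) (N : ℕ) :
    Module.finrank K (monomialSpan K x N) ≤ 4 * (N + 1) := by
  refine (finrank_range_le_card _).trans (le_of_eq ?_)
  simp
  ring

include h

/-- Rewriting to ordered form raises the exponent of $x_3$ by at most one. -/
lemma QuadraticRelations.gen_mul_mem_monomialSpan (N : ℕ) (l : Fin 3) {y : A}
    (hy : y ∈ monomialSpan K x N) : x l * y ∈ monomialSpan K x (N + 1) := by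
  induction hy using Submodule.span_induction with
  | zero => simp
  | add y z _ _ hy hz => rw [mul_add]; exact Submodule.add_mem _ hy hz
  | smul c y _ hy => rw [mul_smul_comm]; exact Submodule.smul_mem _ c hy
  | mem y hy =>
    obtain ⟨⟨i, j, m⟩, rfl⟩ := hy
    have hm : (m : ℕ) ≤ N := by have := m.2; omega
    have m00 (m) (hm : m ≤ N + 1) : x 2 ^ m ∈ monomialSpan K x (N + 1) := by
      simpa using monomial_mem_monomialSpan (K := K) x (i := 0) (j := 0) (by omega) (by omega) hm
    have m10 (m) (hm : m ≤ N + 1) : x 0 * x 2 ^ m ∈ monomialSpan K x (N + 1) := by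
      simpa using monomial_mem_monomialSpan (K := K) x (i := 1) (j := 0) (by omega) (by omega) hm
    have m01 (m) (hm : m ≤ N + 1) : x 1 * x 2 ^ m ∈ monomialSpan K x (N + 1) := by
      simpa using monomial_mem_monomialSpan (K := K) x (i := 0) (j := 1) (by omega) (by omega) hm
    have m11 (m) (hm : m ≤ N + 1) : x 0 * (x 1 * x 2 ^ m) ∈ monomialSpan K x (N + 1) := by
      simpa [mul_assoc] using
        monomial_mem_monomialSpan (K := K) x (i := 1) (j := 1) (by omega) (by omega) hm
    have s00 := m00 m (by omega)
    have s10 := m10 m (by omega)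
    have s01 := m01 m (by omega)
    have s11 := m11 m (by omega)
    have t00 := m00 (m + 1) (by omega)
    have t10 := m10 (m + 1) (by omega)
    have t01 := m01 (m + 1) (by omega)
    have t11 := m11 (m + 1) (by omega)
    rw [pow_succ'] at t00 t10 t01 t11
    fin_cases i <;> fin_cases j <;> fin_cases l <;>
    · simp only [Fin.mk_zero, Fin.mk_one, Fin.reduceFinMk,
        pow_zero, pow_one, one_mul, mul_one, mul_assoc, h.x00', h.x10', h.x11', h.x20', h.x21',
        mul_add, mul_sub, mul_neg, mul_smul_comm, smul_zero, neg_zero, sub_zero,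
        add_zero, neg_neg]
      repeat' first
        | assumption
        | exact Submodule.zero_mem _
        | apply Submodule.sub_mem
        | apply Submodule.add_mem
        | apply Submodule.neg_mem
        | apply Submodule.smul_mem

lemma QuadraticRelations.iSup_monomialSpan (hx : Function.Surjective (FreeAlgebra.lift K x)) :
    ⨆ N, monomialSpan K x N = ⊤ := by
  have hmem (y : A) : y ∈ ⨆ N, monomialSpan K x N ↔ ∃ N, y ∈ monomialSpan K x N :=
    Submodule.mem_iSup_of_directed _ (monomialSpan_mono x).directed_le
  refine eq_top_of_gen_mul_mem hx _ ((hmem _).2 ⟨0, one_mem_monomialSpan x 0⟩) fun l y hy => ?_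
  obtain ⟨N, hN⟩ := (hmem y).1 hy
  exact (hmem _).2 ⟨N + 1, h.gen_mul_mem_monomialSpan N l hN⟩

/-- The span of `1` and the generators. -/
def genSpan (K : Type*) [Field K] {A : Type*} [Ring A] [Algebra K A] (x : Fin 3 → A) :
    Submodule K A :=
  Submodule.span K (insert 1 (Set.range x))

omit h in
lemma one_le_genSpan (x : Fin 3 → A) : 1 ≤ genSpan K x := by
  rw [Submodule.one_le]
  exact Submodule.subset_span (Set.mem_insert _ _)

omit h in
lemma gen_mem_genSpan (x : Fin 3 → A) (l : Fin 3) : x l ∈ genSpan K x :=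
  Submodule.subset_span (Set.mem_insert_of_mem _ ⟨l, rfl⟩)

lemma QuadraticRelations.genSpan_pow_le (N : ℕ) : genSpan K x ^ N ≤ monomialSpan K x N := by
  induction N with
  | zero =>
    rw [pow_zero, Submodule.one_le]
    exact one_mem_monomialSpan x 0
  | succ N ih =>
    rw [pow_succ']
    refine (mul_le_mul_right ih _).trans (Submodule.mul_le.2 fun u hu y hy => ?_)
    induction hu using Submodule.span_induction with
    | zero => simp
    | add u v _ _ hu hv => rw [add_mul]; exact Submodule.add_mem _ hu hv
    | smul c u _ hu => rw [smul_mul_assoc]; exact Submodule.smul_mem _ c hu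
    | mem u hu =>
      rcases hu with rfl | ⟨l, rfl⟩
      · rw [one_mul]; exact monomialSpan_mono x (Nat.le_succ N) hy
      · exact h.gen_mul_mem_monomialSpan N l hy

omit h in
lemma genSpan_pow_mono (x : Fin 3 → A) : Monotone fun N => genSpan K x ^ N :=
  fun _ _ h => pow_le_pow_right₀ (one_le_genSpan x) h

omit h in
lemma exists_le_genSpan_pow (hx : Function.Surjective (FreeAlgebra.lift K x))
    {W : Submodule K A} (hW : W.FG) : ∃ N, W ≤ genSpan K x ^ N := by
  have hmem (y : A) : y ∈ ⨆ N, genSpan K x ^ N ↔ ∃ N, y ∈ genSpan K x ^ N :=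
    Submodule.mem_iSup_of_directed _ (genSpan_pow_mono x).directed_le
  have htop : ⨆ N, genSpan K x ^ N = ⊤ := by
    refine eq_top_of_gen_mul_mem hx _ ((hmem _).2 ⟨0, by rw [pow_zero]; exact Submodule.one_le.1 le_rfl⟩) fun l y hy => ?_
    obtain ⟨N, hN⟩ := (hmem y).1 hy
    refine (hmem _).2 ⟨N + 1, ?_⟩
    rw [pow_succ']
    exact Submodule.mul_mem_mul (gen_mem_genSpan x l) hN
  obtain ⟨s, rfl⟩ := hW
  have hall (y : A) : ∃ N, y ∈ genSpan K x ^ N := (hmem y).1 (htop ▸ trivial)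
  choose N hN using hall
  refine ⟨s.sup N, Submodule.span_le.2 fun y hy => ?_⟩
  exact genSpan_pow_mono x (Finset.le_sup hy) (hN y)

lemma QuadraticRelations.exists_finrank_le (hx : Function.Surjective (FreeAlgebra.lift K x))
    {W : Submodule K A} (hW : W.FG) : ∃ C : ℕ, ∀ n : ℕ,
      Module.finrank K (⨆ i ∈ Finset.range (n + 1), W ^ i : Submodule K A) ≤ C * (n + 1) := by
  obtain ⟨N, hN⟩ := exists_le_genSpan_pow hx hW
  refine ⟨4 * (N + 1), fun n => ?_⟩
  -- With $G$ the span of $1$ and the generators, $W\le G^N$ gives $W^i\le G^{Nn}$ for $i\le n$, and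
  -- $4(Nn+1)\le 4(N+1)(n+1)$.
  have hle : (⨆ i ∈ Finset.range (n + 1), W ^ i : Submodule K A) ≤ monomialSpan K x (N * n) := by
    refine iSup₂_le fun i hi => ?_
    refine (pow_le_pow_left' hN i).trans ?_
    rw [← pow_mul]
    refine (genSpan_pow_mono x (Nat.mul_le_mul_left N ?_)).trans (h.genSpan_pow_le _)
    have := Finset.mem_range.1 hi
    omega
  refine (Submodule.finrank_mono hle).trans ((finrank_monomialSpan_le x _).trans ?_)
  nlinarith

lemma QuadraticRelations.le_finrank (hind : LinearIndependent K fun n : ℕ => x 2 ^ n) (n : ℕ) :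
    n + 1 ≤ Module.finrank K
      (⨆ i ∈ Finset.range (n + 1), genSpan K x ^ i : Submodule K A) := by
  have hle : (⨆ i ∈ Finset.range (n + 1), genSpan K x ^ i : Submodule K A) ≤
      monomialSpan K x n := by
    refine iSup₂_le fun i hi => (h.genSpan_pow_le i).trans (monomialSpan_mono x ?_)
    have := Finset.mem_range.1 hi
    omega
  have : FiniteDimensional K (⨆ i ∈ Finset.range (n + 1), genSpan K x ^ i : Submodule K A) :=
    Submodule.finiteDimensional_of_le hle
  have hind' : LinearIndependent K fun m : Fin (n + 1) => x 2 ^ (m : ℕ) :=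
    hind.comp _ Fin.val_injective
  have hspan : Submodule.span K (Set.range fun m : Fin (n + 1) => x 2 ^ (m : ℕ)) ≤
      ⨆ i ∈ Finset.range (n + 1), genSpan K x ^ i := by
    refine Submodule.span_le.2 ?_
    rintro _ ⟨m, rfl⟩
    exact Submodule.mem_iSup_of_mem (m : ℕ) (Submodule.mem_iSup_of_mem (Finset.mem_range.2 m.2)
      (Submodule.pow_mem_pow _ (gen_mem_genSpan x 2) _))
  have := Submodule.finrank_mono hspan
  rwa [finrank_span_eq_card hind', Fintype.card_fin] at this

end Spanning

/-! ### Gelfand–Kirillov dimension of linear growth -/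

section Growth

open Filter Topology

/-- Squeeze using $Cn\le C(n+1)\le 2Cn$ for $n\ge1$. -/
lemma tendsto_log_mul_succ_div_log {C : ℝ} (hC : 0 < C) :
    Tendsto (fun n : ℕ => Real.log (C * (n + 1)) / Real.log n) atTop (𝓝 1) := by
  have hlog : Tendsto (fun n : ℕ => Real.log n) atTop atTop :=
    Real.tendsto_log_atTop.comp tendsto_natCast_atTop_atTop
  have h1 : Tendsto (fun n : ℕ => Real.log (C * 2) / Real.log n) atTop (𝓝 0) :=
    hlog.const_div_atTop _
  have h2 : Tendsto (fun n : ℕ => Real.log C / Real.log n) atTop (𝓝 0) :=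
    hlog.const_div_atTop _
  have hev : ∀ᶠ n : ℕ in atTop, 0 < Real.log n := hlog.eventually_gt_atTop 0
  refine tendsto_of_tendsto_of_tendsto_of_le_of_le' (g := fun n : ℕ => Real.log C / Real.log n + 1)
    (h := fun n : ℕ => Real.log (C * 2) / Real.log n + 1) (by simpa using h2.add_const 1)
    (by simpa using h1.add_const 1) ?_ ?_
  · filter_upwards [hev, eventually_ge_atTop 1] with n hn h1
    have h1' : (1 : ℝ) ≤ n := by exact_mod_cast h1
    rw [div_add_one hn.ne', ← Real.log_mul hC.ne' (by positivity)]
    gcongr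
    linarith
  · filter_upwards [hev, eventually_ge_atTop 1] with n hn h1
    have h1' : (1 : ℝ) ≤ n := by exact_mod_cast h1
    rw [div_add_one hn.ne', ← Real.log_mul (by positivity) (by positivity), mul_assoc]
    gcongr
    linarith

variable {K : Type*} [Field K] {A : Type*} [Ring A] [Algebra K A]

lemma gkDim_eq_one
    (hub : ∀ W : Submodule K A, W.FG → ∃ C : ℕ, ∀ n : ℕ,
      Module.finrank K (⨆ i ∈ Finset.range (n + 1), W ^ i : Submodule K A) ≤ C * (n + 1))
    (hlb : ∃ W : Submodule K A, W.FG ∧ ∀ n : ℕ,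
      n + 1 ≤ Module.finrank K (⨆ i ∈ Finset.range (n + 1), W ^ i : Submodule K A)) :
    gkDim K A = 1 := by
  refine le_antisymm (iSup₂_le fun W hW => ?_) ?_
  · obtain ⟨C, hC⟩ := hub W hW
    -- `C + 1` replaces `C` to guarantee a positive constant.
    have ht : Tendsto (fun n : ℕ => ((Real.log (((C + 1 : ℕ) : ℝ) * (n + 1)) / Real.log n : ℝ) :
        EReal)) atTop (𝓝 1) :=
      (continuous_coe_real_ereal.tendsto (1 : ℝ)).comp
        (tendsto_log_mul_succ_div_log (by positivity))
    rw [← ht.limsup_eq]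
    refine limsup_le_limsup ?_
    filter_upwards with n
    rw [EReal.coe_le_coe_iff]
    refine div_le_div_of_nonneg_right ?_ (Real.log_natCast_nonneg n)
    rcases Nat.eq_zero_or_pos
      (Module.finrank K (⨆ i ∈ Finset.range (n + 1), W ^ i : Submodule K A)) with h0 | h0
    · rw [h0, Nat.cast_zero, Real.log_zero]
      exact_mod_cast Real.log_natCast_nonneg ((C + 1) * (n + 1))
    · refine Real.log_le_log (by exact_mod_cast h0) ?_
      exact_mod_cast (hC n).trans (Nat.mul_le_mul_right _ (Nat.le_succ C))
  · obtain ⟨W, hW, hn⟩ := hlb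
    refine le_trans ?_ (le_iSup₂_of_le W hW le_rfl)
    have ht : Tendsto (fun n : ℕ => ((Real.log (1 * ((n : ℝ) + 1)) / Real.log n : ℝ) :
        EReal)) atTop (𝓝 1) :=
      (continuous_coe_real_ereal.tendsto (1 : ℝ)).comp (tendsto_log_mul_succ_div_log one_pos)
    rw [← ht.limsup_eq]
    refine limsup_le_limsup ?_
    filter_upwards with n
    rw [EReal.coe_le_coe_iff]
    refine div_le_div_of_nonneg_right ?_ (Real.log_natCast_nonneg n)
    refine Real.log_le_log (by positivity) ?_
    rw [one_mul]
    exact_mod_cast hn n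

end Growth

/-! ### PBW bases in the two cases -/

section PBW

open Polynomial

variable {K : Type*} [Field K] [CharZero K] {A : Type*} [Ring A] [Algebra K A]
variable {a b k ℓ q : K} {x : Fin 3 → A} {d : Fin 3 → A →ₗ[K] A} {ε : A →ₐ[K] K}

/-- The sum of the ordered elements `x_1^i x_2^j P_{ij}(x_3)` with `i, j < 2`. -/
def orderedMap (K : Type*) [Field K] {A : Type*} [Ring A] [Algebra K A] (x : Fin 3 → A) :
    (Fin 2 × Fin 2 → K[X]) →ₗ[K] A :=
  ∑ ij : Fin 2 × Fin 2, (LinearMap.mulLeft K (x 0 ^ (ij.1 : ℕ) * x 1 ^ (ij.2 : ℕ))).comp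
    ((aeval (x 2)).toLinearMap.comp (LinearMap.proj ij))

lemma orderedMap_apply (x : Fin 3 → A) (P : Fin 2 × Fin 2 → K[X]) :
    orderedMap K x P = ∑ ij : Fin 2 × Fin 2,
      x 0 ^ (ij.1 : ℕ) * x 1 ^ (ij.2 : ℕ) * aeval (x 2) (P ij) := by
  simp [orderedMap, mul_assoc]

lemma orderedMap_single (x : Fin 3 → A) (ij : Fin 2 × Fin 2) (P : K[X]) :
    orderedMap K x (Pi.single ij P) = x 0 ^ (ij.1 : ℕ) * x 1 ^ (ij.2 : ℕ) * aeval (x 2) P := by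
  rw [orderedMap_apply, Finset.sum_eq_single ij]
  · rw [Pi.single_eq_same]
  · intro ij' _ hne
    rw [Pi.single_eq_of_ne hne, map_zero, mul_zero]
  · simp

lemma SkewDerivations.orderedMap_eq_zero (h : QuadraticRelations ℓ q x)
    (hd : SkewDerivations (braiding15 (-1) 0 a b k ℓ q) x d ε) (hab : b * ℓ - a ≠ 0)
    (P : Fin 2 × Fin 2 → K[X]) (hu : ∀ w, iterDer d ε w (orderedMap K x P) = 0) : P = 0 := by
  obtain ⟨h00, h10, h01, h11⟩ := hd.elim_ordered h hab (P := P (0, 0)) (Q := P (1, 0))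
    (R := P (0, 1)) (S := P (1, 1)) fun w => by
      rw [← hu w, orderedMap_apply]
      congr 1
      simp [Fintype.sum_prod_type, Fin.sum_univ_two, mul_assoc]
      abel
  funext ⟨i, j⟩
  fin_cases i <;> fin_cases j <;> assumption

/-- These monomials are the image of the monomial basis of four copies of `K[X]` under the injective
map `orderedMap`. -/
lemma SkewDerivations.linearIndependent_monomials (h : QuadraticRelations ℓ q x)
    (hd : SkewDerivations (braiding15 (-1) 0 a b k ℓ q) x d ε) (hab : b * ℓ - a ≠ 0) :
    LinearIndependent K fun e : (_ : Fin 2 × Fin 2) × ℕ =>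
      x 0 ^ (e.1.1 : ℕ) * x 1 ^ (e.1.2 : ℕ) * x 2 ^ e.2 := by
  have hker : LinearMap.ker (orderedMap K x) = ⊥ := by
    rw [LinearMap.ker_eq_bot']
    exact fun P hP => hd.orderedMap_eq_zero h hab P fun w => by rw [hP, map_zero]
  have hcomp : (fun e : (_ : Fin 2 × Fin 2) × ℕ =>
      x 0 ^ (e.1.1 : ℕ) * x 1 ^ (e.1.2 : ℕ) * x 2 ^ e.2) =
      orderedMap K x ∘ Pi.basis fun _ : Fin 2 × Fin 2 => basisMonomials K := by
    funext e
    simp [Pi.basis_apply, orderedMap_single]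
  rw [hcomp]
  exact (Pi.basis fun _ : Fin 2 × Fin 2 => basisMonomials K).linearIndependent.map' _ hker

lemma SkewDerivations.separates (h : QuadraticRelations ℓ q x)
    (hx : Function.Surjective (FreeAlgebra.lift K x))
    (hd : SkewDerivations (braiding15 (-1) 0 a b k ℓ q) x d ε) (hab : b * ℓ - a ≠ 0)
    (u : A) (hu : ∀ w, iterDer d ε w u = 0) : u = 0 := by
  have htop : LinearMap.range (orderedMap K x) = ⊤ := by
    rw [eq_top_iff, ← h.iSup_monomialSpan hx]
    refine iSup_le fun N => Submodule.span_le.2 ?_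
    rintro _ ⟨⟨i, j, m⟩, rfl⟩
    exact ⟨Pi.single (i, j) (X ^ (m : ℕ)), by simp [orderedMap_single]⟩
  obtain ⟨P, rfl⟩ := LinearMap.range_eq_top.1 htop u
  rw [hd.orderedMap_eq_zero h hab P hu, map_zero]

lemma SkewDerivations.isPBWBasis (h : QuadraticRelations ℓ q x)
    (hx : Function.Surjective (FreeAlgebra.lift K x))
    (hd : SkewDerivations (braiding15 (-1) 0 a b k ℓ q) x d ε) (hab : b * ℓ - a ≠ 0) :
    IsPBWBasis K x ![2, 2, ⊤] := by
  constructor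
  · let f : {e : Fin 3 → ℕ // ∀ i, (e i : ℕ∞) < (![2, 2, ⊤] : Fin 3 → ℕ∞) i} →
        (_ : Fin 2 × Fin 2) × ℕ := fun e =>
      ⟨(⟨e.1 0, by exact_mod_cast (show (e.1 0 : ℕ∞) < 2 from e.2 0)⟩,
        ⟨e.1 1, by exact_mod_cast (show (e.1 1 : ℕ∞) < 2 from e.2 1)⟩), e.1 2⟩
    have hf : Function.Injective f := by
      intro e e' hee
      simp only [f, Sigma.mk.injEq, Prod.mk.injEq, Fin.mk.injEq, heq_eq_eq] at hee
      ext i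
      fin_cases i
      exacts [hee.1.1, hee.1.2, hee.2]
    exact (hd.linearIndependent_monomials h hab).comp f hf
  · rw [eq_top_iff, ← h.iSup_monomialSpan hx]
    refine iSup_le fun N => Submodule.span_le.2 ?_
    rintro _ ⟨⟨i, j, m⟩, rfl⟩
    refine Submodule.subset_span ⟨⟨![i, j, m], fun l => ?_⟩, rfl⟩
    fin_cases l
    · simpa using (by exact_mod_cast i.2 : ((i : ℕ) : ℕ∞) < 2)
    · simpa using (by exact_mod_cast j.2 : ((j : ℕ) : ℕ∞) < 2)
    · exact ENat.natCast_lt_top _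

lemma SkewDerivations.gkDim_eq_one (h : QuadraticRelations ℓ q x)
    (hx : Function.Surjective (FreeAlgebra.lift K x))
    (hd : SkewDerivations (braiding15 (-1) 0 a b k ℓ q) x d ε) (hab : b * ℓ - a ≠ 0) :
    gkDim K A = 1 := by
  refine NicholsRankThree.gkDim_eq_one (fun W hW => h.exists_finrank_le hx hW)
    ⟨genSpan K x, Submodule.fg_span ((Set.finite_range x).insert 1), h.le_finrank ?_⟩
  have := (hd.linearIndependent_monomials h hab).comp (fun n : ℕ => ⟨(0, 0), n⟩)
    fun n m hnm => by simpa using hnm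
  simpa [Function.comp_def] using this

/-- The extra relation turns $x_3^2$ into a multiple of $x_1x_2$, so exponent at most one in $x_3$
is stable under left multiplication by generators. -/
lemma QuadraticRelations.monomialSpan_one_eq_top (h : QuadraticRelations ℓ q x)
    (hx : Function.Surjective (FreeAlgebra.lift K x)) (h22 : x 2 * x 2 = -(b • (x 0 * x 1))) :
    monomialSpan K x 1 = ⊤ := by
  have hle : monomialSpan K x 2 ≤ monomialSpan K x 1 := by
    refine Submodule.span_le.2 ?_
    rintro _ ⟨⟨i, j, m⟩, rfl⟩
    by_cases hm : (m : ℕ) ≤ 1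
    · exact monomial_mem_monomialSpan x i.2 j.2 hm
    · have hm2 : (m : ℕ) = 2 := by have := m.2; omega
      have h11 : x 0 * x 1 ∈ monomialSpan K x 1 := by
        simpa using monomial_mem_monomialSpan (K := K) x (N := 1) (i := 1) (j := 1) (m := 0)
          (by omega) (by omega) (by omega)
      simp only [hm2, pow_two, h22, SetLike.mem_coe]
      fin_cases i <;> fin_cases j <;>
        simp [mul_assoc, h.x00', h.x10', h.x11, Submodule.smul_mem _ _ h11]
  exact eq_top_of_gen_mul_mem hx _ (one_mem_monomialSpan x 1) fun l y hy =>
    hle (h.gen_mul_mem_monomialSpan 1 l hy)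

/-- Constants are admissible whatever $b\ell-a$ is, so `elim_three` applies to the eight scalars
directly. -/
lemma SkewDerivations.coeff_eq_zero (h : QuadraticRelations ℓ q x)
    (hd : SkewDerivations (braiding15 (-1) 0 a b k ℓ q) x d ε)
    (c : Fin 2 × Fin 2 × Fin 2 → K)
    (hu : ∀ w, iterDer d ε w (∑ e, c e •
      (x 0 ^ (e.1 : ℕ) * x 1 ^ (e.2.1 : ℕ) * x 2 ^ (e.2.2 : ℕ))) = 0) : c = 0 := by
  have hC (s : K) : C s ∈ admissible (b * ℓ - a) := Or.inl (natDegree_C s)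
  have key := hd.elim_three h (hC (c (0, 0, 0))) (hC (c (1, 0, 0))) (hC (c (0, 1, 0)))
    (hC (c (1, 1, 0))) (hC (c (0, 0, 1))) (hC (c (1, 0, 1))) (hC (c (0, 1, 1)))
    (hC (c (1, 1, 1))) fun w => by
      rw [← hu w]
      congr 1
      simp [Fintype.sum_prod_type, Fin.sum_univ_two, mul_assoc, Algebra.algebraMap_eq_smul_one]
      abel
  simp only [C_eq_zero] at key
  obtain ⟨⟨h1, h2, h3, h4⟩, h5, h6, h7, h8⟩ := key
  funext ⟨i, j, m⟩
  fin_cases i <;> fin_cases j <;> fin_cases m <;> assumption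

lemma SkewDerivations.linearIndependent_squarefree (h : QuadraticRelations ℓ q x)
    (hd : SkewDerivations (braiding15 (-1) 0 a b k ℓ q) x d ε) :
    LinearIndependent K fun e : Fin 2 × Fin 2 × Fin 2 =>
      x 0 ^ (e.1 : ℕ) * x 1 ^ (e.2.1 : ℕ) * x 2 ^ (e.2.2 : ℕ) := by
  rw [Fintype.linearIndependent_iff]
  exact fun c hc => congrFun (hd.coeff_eq_zero h c fun w => by rw [hc, map_zero])

lemma SkewDerivations.separates' (h : QuadraticRelations ℓ q x)
    (hx : Function.Surjective (FreeAlgebra.lift K x)) (h22 : x 2 * x 2 = -(b • (x 0 * x 1)))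
    (hd : SkewDerivations (braiding15 (-1) 0 a b k ℓ q) x d ε)
    (u : A) (hu : ∀ w, iterDer d ε w u = 0) : u = 0 := by
  have hmem : u ∈ monomialSpan K x 1 := by
    rw [h.monomialSpan_one_eq_top hx h22]
    trivial
  obtain ⟨c, rfl⟩ := (Submodule.mem_span_range_iff_exists_fun K).1 hmem
  simp [hd.coeff_eq_zero h c hu]

lemma SkewDerivations.isPBWBasis' (h : QuadraticRelations ℓ q x)
    (hx : Function.Surjective (FreeAlgebra.lift K x)) (h22 : x 2 * x 2 = -(b • (x 0 * x 1)))
    (hd : SkewDerivations (braiding15 (-1) 0 a b k ℓ q) x d ε) :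
    IsPBWBasis K x ![2, 2, 2] := by
  constructor
  · let f : {e : Fin 3 → ℕ // ∀ i, (e i : ℕ∞) < (![2, 2, 2] : Fin 3 → ℕ∞) i} →
        Fin 2 × Fin 2 × Fin 2 := fun e =>
      (⟨e.1 0, by exact_mod_cast (show (e.1 0 : ℕ∞) < 2 from e.2 0)⟩,
        ⟨e.1 1, by exact_mod_cast (show (e.1 1 : ℕ∞) < 2 from e.2 1)⟩,
        ⟨e.1 2, by exact_mod_cast (show (e.1 2 : ℕ∞) < 2 from e.2 2)⟩)
    have hf : Function.Injective f := by
      intro e e' hee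
      simp only [f, Prod.mk.injEq, Fin.mk.injEq] at hee
      ext i
      fin_cases i
      exacts [hee.1, hee.2.1, hee.2.2]
    exact (hd.linearIndependent_squarefree h).comp f hf
  · rw [eq_top_iff, ← h.monomialSpan_one_eq_top hx h22]
    refine Submodule.span_le.2 ?_
    rintro _ ⟨⟨i, j, m⟩, rfl⟩
    refine Submodule.subset_span ⟨⟨![i, j, m], fun l => ?_⟩, rfl⟩
    fin_cases l
    · simpa using (by exact_mod_cast i.2 : ((i : ℕ) : ℕ∞) < 2)
    · simpa using (by exact_mod_cast j.2 : ((j : ℕ) : ℕ∞) < 2)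
    · simpa using (by exact_mod_cast m.2 : ((m : ℕ) : ℕ∞) < 2)

lemma SkewDerivations.finrank_eq_eight (h : QuadraticRelations ℓ q x)
    (hx : Function.Surjective (FreeAlgebra.lift K x)) (h22 : x 2 * x 2 = -(b • (x 0 * x 1)))
    (hd : SkewDerivations (braiding15 (-1) 0 a b k ℓ q) x d ε) : Module.finrank K A = 8 := by
  rw [← finrank_top K A, ← h.monomialSpan_one_eq_top hx h22]
  exact (finrank_span_eq_card (hd.linearIndependent_squarefree h)).trans (by simp)

end PBW

/-! ### Presentations and two-sided ideals -/

section Quotient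

variable {K : Type*} [Field K]

lemma lift_mk_eq_mkₐ {ι : Type*} (I : TwoSidedIdeal (FreeAlgebra K ι)) :
    FreeAlgebra.lift K (fun i => Ideal.Quotient.mk I.asIdeal (FreeAlgebra.ι K i)) =
      Ideal.Quotient.mkₐ K I.asIdeal :=
  FreeAlgebra.hom_ext (by ext; simp)

/-- A presentation of an algebra by relations that is compatible with a braiding and separated by
the skew derivations is a presentation of the Nichols algebra. -/
lemma defRel_eq_of_separates {ι : Type*} [Fintype ι] [DecidableEq ι]
    {r : Matrix (ι × ι) (ι × ι) K} {I : TwoSidedIdeal (FreeAlgebra K ι)}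
    {d : ι → (FreeAlgebra K ι ⧸ I.asIdeal) →ₗ[K] (FreeAlgebra K ι ⧸ I.asIdeal)}
    {ε : (FreeAlgebra K ι ⧸ I.asIdeal) →ₐ[K] K}
    (hd : SkewDerivations r (fun i => Ideal.Quotient.mk I.asIdeal (FreeAlgebra.ι K i)) d ε)
    (hsep : ∀ u, (∀ w, iterDer d ε w u = 0) → u = 0) :
    (defRel r : Set (FreeAlgebra K ι)) = I := by
  ext y
  rw [SetLike.mem_coe, hd.mem_defRel_iff hsep]
  rw [lift_mk_eq_mkₐ]
  exact Ideal.Quotient.eq_zero_iff_mem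

lemma surjective_lift_mk {ι : Type*} (I : TwoSidedIdeal (FreeAlgebra K ι)) :
    Function.Surjective
      (FreeAlgebra.lift K fun i => Ideal.Quotient.mk I.asIdeal (FreeAlgebra.ι K i)) := by
  rw [lift_mk_eq_mkₐ]
  exact Ideal.Quotient.mk_surjective

lemma TwoSidedIdeal.span_coe {R : Type*} [Ring R] (I : TwoSidedIdeal R) :
    TwoSidedIdeal.span (I : Set R) = I :=
  le_antisymm (TwoSidedIdeal.span_le.2 subset_rfl) TwoSidedIdeal.subset_span

/-- The quadratic relations that hold for all values of the parameters. -/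
def commonRels (ℓ q : K) : Set (FreeAlgebra K (Fin 3)) :=
  {x₂ K * x₁ K + x₁ K * x₂ K, x₃ K * x₁ K + x₁ K * x₃ K,
    x₃ K * x₂ K + x₂ K * x₃ K - ℓ • (x₁ K * x₃ K) + q • (x₁ K * x₂ K),
    x₁ K ^ 2, x₂ K ^ 2 - ℓ • (x₁ K * x₂ K)}

variable {A : Type*} [Ring A] [Algebra K A] {ℓ q : K} {x : Fin 3 → A}

/-- The algebra is arbitrary because this serves three: the quotient, the operators `skewOp`, and
`K` with zero generators for the counit. -/
lemma quadraticRelations_iff :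
    QuadraticRelations ℓ q x ↔ ∀ u ∈ commonRels ℓ q, FreeAlgebra.lift K x u = 0 := by
  simp only [commonRels, Set.mem_insert_iff, Set.mem_singleton_iff, forall_eq_or_imp, forall_eq,
    map_add, map_sub, map_mul, map_smul, FreeAlgebra.lift_ι_apply, pow_two]
  constructor
  · intro h
    refine ⟨?_, ?_, ?_, h.x00, ?_⟩
    · rw [h.x10, neg_add_cancel]
    · rw [h.x20, neg_add_cancel]
    · rw [h.x21]; abel
    · rw [h.x11, sub_self]
  · rintro ⟨h10, h20, h21, h00, h11⟩
    refine ⟨h00, eq_neg_of_add_eq_zero_left h10, sub_eq_zero.1 h11,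
      eq_neg_of_add_eq_zero_left h20, ?_⟩
    rw [← sub_eq_zero, ← h21]
    abel

lemma lift_eq_zero_of_mem_span {ι : Type*} {y : ι → A} {s : Set (FreeAlgebra K ι)}
    (h : ∀ u ∈ s, FreeAlgebra.lift K y u = 0) :
    ∀ u ∈ TwoSidedIdeal.span s, FreeAlgebra.lift K y u = 0 := by
  have : TwoSidedIdeal.span s ≤ TwoSidedIdeal.ker (FreeAlgebra.lift K y) :=
    TwoSidedIdeal.span_le.2 fun u hu => (TwoSidedIdeal.mem_ker _).2 (h u hu)
  exact fun u hu => (TwoSidedIdeal.mem_ker _).1 (this hu)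

lemma lift_mk_eq_zero {ι : Type*} {s : Set (FreeAlgebra K ι)} (u : FreeAlgebra K ι) (hu : u ∈ s) :
    FreeAlgebra.lift K (fun i => Ideal.Quotient.mk (TwoSidedIdeal.span s).asIdeal
      (FreeAlgebra.ι K i)) u = 0 := by
  rw [lift_mk_eq_mkₐ]
  exact Ideal.Quotient.eq_zero_iff_mem.2 (TwoSidedIdeal.subset_span hu)

end Quotient

/-! ### The two cases -/

section Main

variable {K : Type*} [Field K] [CharZero K]

lemma nichols_of_ne (a b k ℓ q : K) (hab : a ≠ b * ℓ) :
    (defRel (braiding15 (-1) 0 a b k ℓ q) : Set (FreeAlgebra K (Fin 3))) =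
        TwoSidedIdeal.span (commonRels ℓ q) ∧
      IsPBWBasis K (NicholsAlgebra.gen (braiding15 (-1) 0 a b k ℓ q)) ![2, 2, ⊤] ∧
      gkDim K (NicholsAlgebra (braiding15 (-1) 0 a b k ℓ q)) = 1 := by
  set I := TwoSidedIdeal.span (commonRels ℓ q) with hI
  have hrel : QuadraticRelations ℓ q
      fun i => Ideal.Quotient.mk I.asIdeal (FreeAlgebra.ι K i) :=
    quadraticRelations_iff.2 fun u hu => lift_mk_eq_zero u hu
  have hx := surjective_lift_mk I
  have hne : b * ℓ - a ≠ 0 := sub_ne_zero.2 hab.symm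
  obtain ⟨d, ε, hd⟩ := exists_skewDerivations (braiding15 (-1) 0 a b k ℓ q) I
    (lift_eq_zero_of_mem_span (quadraticRelations_iff.1 (hrel.skewOp a b k)))
    (lift_eq_zero_of_mem_span (quadraticRelations_iff.1 (by constructor <;> simp)))
  have hdef := defRel_eq_of_separates hd (hd.separates hrel hx hne)
  refine ⟨hdef, ?_⟩
  -- `NicholsAlgebra` is the quotient by the ideal generated by `defRel`, equal to `I` only
  -- propositionally; a general `J` allows substitution in the dependent types.
  have key : ∀ J : TwoSidedIdeal (FreeAlgebra K (Fin 3)), J = I →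
      IsPBWBasis K (fun i => Ideal.Quotient.mk J.asIdeal (FreeAlgebra.ι K i)) ![2, 2, ⊤] ∧
      gkDim K (FreeAlgebra K (Fin 3) ⧸ J.asIdeal) = 1 := by
    rintro _ rfl
    exact ⟨hd.isPBWBasis hrel hx hne, hd.gkDim_eq_one hrel hx hne⟩
  exact key _ (by rw [hdef, TwoSidedIdeal.span_coe])

/-- The relation set enters only through its membership condition, so that the explicit six-element
list can be supplied for `s`. -/
lemma nichols_of_eq (a b k ℓ q : K) (hab : a = b * ℓ) (s : Set (FreeAlgebra K (Fin 3)))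
    (hs : ∀ u, u ∈ s ↔ u ∈ commonRels ℓ q ∨ u = x₃ K ^ 2 + b • (x₁ K * x₂ K)) :
    (defRel (braiding15 (-1) 0 a b k ℓ q) : Set (FreeAlgebra K (Fin 3))) =
        TwoSidedIdeal.span s ∧
      IsPBWBasis K (NicholsAlgebra.gen (braiding15 (-1) 0 a b k ℓ q)) ![2, 2, 2] ∧
      Module.finrank K (NicholsAlgebra (braiding15 (-1) 0 a b k ℓ q)) = 8 := by
  set I := TwoSidedIdeal.span s with hI
  have hmk : ∀ u ∈ s, FreeAlgebra.lift K
      (fun i => Ideal.Quotient.mk I.asIdeal (FreeAlgebra.ι K i)) u = 0 := lift_mk_eq_zero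
  have hrel : QuadraticRelations ℓ q
      fun i => Ideal.Quotient.mk I.asIdeal (FreeAlgebra.ι K i) :=
    quadraticRelations_iff.2 fun u hu => hmk u ((hs u).2 (Or.inl hu))
  have hlift {B : Type _} [Ring B] [Algebra K B] (y : Fin 3 → B) :
      FreeAlgebra.lift K y (x₃ K ^ 2 + b • (x₁ K * x₂ K)) = 0 ↔
        y 2 * y 2 = -(b • (y 0 * y 1)) := by
    simp [pow_two, add_eq_zero_iff_eq_neg]
  have h22 := (hlift _).1 (hmk _ ((hs _).2 (Or.inr rfl)))
  have hx := surjective_lift_mk I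
  obtain ⟨d, ε, hd⟩ := exists_skewDerivations (braiding15 (-1) 0 a b k ℓ q) I
    (lift_eq_zero_of_mem_span fun u hu => ((hs u).1 hu).elim
      (quadraticRelations_iff.1 (hrel.skewOp a b k) u) fun h => h ▸
        (by simpa [pow_two, add_eq_zero_iff_eq_neg] using hrel.skewOp_two_mul_two a b k h22 hab))
    (lift_eq_zero_of_mem_span fun u hu => ((hs u).1 hu).elim
      (quadraticRelations_iff.1 (by constructor <;> simp) u) fun h => h ▸ by simp)
  have hdef := defRel_eq_of_separates hd (hd.separates' hrel hx h22)
  refine ⟨hdef, ?_⟩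
  have key : ∀ J : TwoSidedIdeal (FreeAlgebra K (Fin 3)), J = I →
      IsPBWBasis K (fun i => Ideal.Quotient.mk J.asIdeal (FreeAlgebra.ι K i)) ![2, 2, 2] ∧
      Module.finrank K (FreeAlgebra K (Fin 3) ⧸ J.asIdeal) = 8 := by
    rintro _ rfl
    exact ⟨hd.isPBWBasis' hrel hx h22, hd.finrank_eq_eight hrel hx h22⟩
  exact key _ (by rw [hdef, TwoSidedIdeal.span_coe])

end Main

end

end NicholsRankThree

theorem proposition3p11 {K : Type*} [Field K] [IsAlgClosed K] [CharZero K]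
    (t p a b k ℓ q : K) (ht : t = -1) (hp : p = 0) :
    (a ≠ b * ℓ →
      (defRel (braiding15 t p a b k ℓ q) : Set (FreeAlgebra K (Fin 3))) =
        (TwoSidedIdeal.span
          {x₂ K * x₁ K + x₁ K * x₂ K,
            x₃ K * x₁ K + x₁ K * x₃ K,
            x₃ K * x₂ K + x₂ K * x₃ K - ℓ • (x₁ K * x₃ K) + q • (x₁ K * x₂ K),
            x₁ K ^ 2,
            x₂ K ^ 2 - ℓ • (x₁ K * x₂ K)} : Set (FreeAlgebra K (Fin 3))) ∧
      IsPBWBasis K (NicholsAlgebra.gen (braiding15 t p a b k ℓ q)) ![2, 2, ⊤] ∧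
      gkDim K (NicholsAlgebra (braiding15 t p a b k ℓ q)) = 1) ∧
    (a = b * ℓ →
      (defRel (braiding15 t p a b k ℓ q) : Set (FreeAlgebra K (Fin 3))) =
        (TwoSidedIdeal.span
          {x₂ K * x₁ K + x₁ K * x₂ K,
            x₃ K * x₁ K + x₁ K * x₃ K,
            x₃ K * x₂ K + x₂ K * x₃ K - ℓ • (x₁ K * x₃ K) + q • (x₁ K * x₂ K),
            x₁ K ^ 2,
            x₂ K ^ 2 - ℓ • (x₁ K * x₂ K),
            x₃ K ^ 2 + b • (x₁ K * x₂ K)} : Set (FreeAlgebra K (Fin 3))) ∧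
      IsPBWBasis K (NicholsAlgebra.gen (braiding15 t p a b k ℓ q)) ![2, 2, 2] ∧
      Module.finrank K (NicholsAlgebra (braiding15 t p a b k ℓ q)) = 8) := by

  subst ht hp
  refine ⟨nichols_of_ne a b k ℓ q, fun hab => nichols_of_eq a b k ℓ q hab _ fun u => ?_⟩
  simp only [commonRels, Set.mem_insert_iff, Set.mem_singleton_iff, or_assoc]
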